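/- Let $q$ be a prime power. Identify a point $P=(y_0,\dots,y_5)$ of $\mathrm{PG}(5,q)$ with the symmetric matrix $$M_P=\begin{bmatrix} y_0&y_1&y_2\\ y_1&y_3&y_4\\ y_2&y_4&y_5\end{bmatrix},$$ and call the rank of $M_P$ the rank of $P$. The points of rank $1$ are the points of the Veronese surface $\{(u_0^2,u_0u_1,u_0u_2,u_1^2,u_1u_2,u_2^2)\}$, and its secant variety $\mathcal S$ is the set of points of rank at most $2$. Let a quadratic form $f=\sum_{0\le i\le j\le 2}a_{ij}X_iX_j$ over $\mathbb F_q$ correspond to the hyperplane $a_{00}Y_0+a_{01}Y_1+a_{02}Y_2+a_{11}Y_3+a_{12}Y_4+a_{22}Y_5=0$ of $\mathrm{PG}(5,q)$, and let $$\Delta_f=4a_{00}a_{11}a_{22}+a_{01}a_{02}a_{12}-a_{00}a_{12}^2-a_{11}a_{02}^2-a_{22}a_{01}^2$$ be its discriminant. For a line $L$ of $\mathrm{PG}(5,q)$, the quadratic forms whose hyperplanes contain $L$, together with $0$, form a $4$-dimensional vector space (the web of conics associated with $L$). For a basis $f_1,f_2,f_3,f_4$ of it, the cubic surface associated with $L$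 is the zero locus in $\mathrm{PG}(3,q)$ of $\Delta_{Af_1+Bf_2+Cf_3+Df_4}\in\mathbb F_q[A,B,C,D]$. **Theorem.** Let $L$ be a line of $\mathrm{PG}(5,q)$. For every choice of the basis $f_1,\dots,f_4$, the number of points of $L\cap\mathcal S$ lies in $\{0,1,2,3,q+1\}$, and for each $i\in\{0,1,2,3,q+1\}$, the line $L$ meets $\mathcal S$ in exactly $i$ points if and only if its associated cubic surface has exactly $q^2+iq+1$ $\mathbb F_q$-rational points. -/

import Mathlib

open scoped LinearAlgebra.Projectivization

namespace VeroneseWeb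

/-- The symmetric matrix `M_P` attached to coordinates `(y₀, …, y₅)` of a point `P` of
`PG(5,q)`. -/
def symMatrix {F : Type*} (y : Fin 6 → F) : Matrix (Fin 3) (Fin 3) F :=
  !![y 0, y 1, y 2;
     y 1, y 3, y 4;
     y 2, y 4, y 5]

theorem symMatrix_smul {F : Type*} [Mul F] (c : F) (y : Fin 6 → F) :
    symMatrix (c • y) = c • symMatrix y := by
  ext i j
  fin_cases i <;> fin_cases j <;> rfl

/-- The secant variety of the Veronese surface in `PG(5,q)`: the set of the points of rank at
most `2`, where the rank of a point is the rank of its symmetric matrix. -/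
def secantVariety (F : Type*) [Field F] : Set (ℙ F (Fin 6 → F)) :=
  {P | (symMatrix P.rep).rank ≤ 2}

/-- Membership in the secant variety can be tested on any homogeneous coordinates. -/
theorem mk_mem_secantVariety {F : Type*} [Field F] (y : Fin 6 → F) (hy : y ≠ 0) :
    Projectivization.mk F y hy ∈ secantVariety F ↔ (symMatrix y).rank ≤ 2 := by
  obtain ⟨a, ha⟩ := Projectivization.exists_smul_eq_mk_rep F y hy
  have h : symMatrix (Projectivization.mk F y hy).rep = (a : F) • symMatrix y := by
    rw [← ha, ← symMatrix_smul]; rfl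
  have hr : ((a : F) • symMatrix y).rank = (symMatrix y).rank := by
    have h1 : (a : F) • symMatrix y = symMatrix y * ((a : F) • (1 : Matrix (Fin 3) (Fin 3) F)) := by
      simp
    rw [h1]
    apply Matrix.rank_mul_eq_left_of_isUnit_det
    simp
  simp only [secantVariety, Set.mem_ofPred_eq, h, hr]

/-- The set of points of the projective subspace `PG(W)`. -/
def points {F V : Type*} [Field F] [AddCommGroup V] [Module F V] (W : Submodule F V) :
    Set (ℙ F V) :=
  {P | P.submodule ≤ W}

/-- The coefficient `a_{ij}` of `X_i X_j` in a ternary form. -/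
noncomputable def quadCoeff {R : Type*} [CommRing R] (f : MvPolynomial (Fin 3) R)
    (i j : Fin 3) : R :=
  f.coeff (Finsupp.single i 1 + Finsupp.single j 1)

/-- The discriminant of a ternary quadratic form `∑_{i ≤ j} a_{ij} X_i X_j`. -/
noncomputable def discr {R : Type*} [CommRing R] (f : MvPolynomial (Fin 3) R) : R :=
  4 * quadCoeff f 0 0 * quadCoeff f 1 1 * quadCoeff f 2 2
    + quadCoeff f 0 1 * quadCoeff f 0 2 * quadCoeff f 1 2
    - quadCoeff f 0 0 * quadCoeff f 1 2 ^ 2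
    - quadCoeff f 1 1 * quadCoeff f 0 2 ^ 2
    - quadCoeff f 2 2 * quadCoeff f 0 1 ^ 2

/-- The linear form on the coordinates of `PG(5,q)` that defines the hyperplane corresponding
to the conic with equation `f`:
`a₀₀ Y₀ + a₀₁ Y₁ + a₀₂ Y₂ + a₁₁ Y₃ + a₁₂ Y₄ + a₂₂ Y₅`. -/
noncomputable def hyperplaneForm {F : Type*} [Field F] (f : MvPolynomial (Fin 3) F)
    (y : Fin 6 → F) : F :=
  quadCoeff f 0 0 * y 0 + quadCoeff f 0 1 * y 1 + quadCoeff f 0 2 * y 2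
    + quadCoeff f 1 1 * y 3 + quadCoeff f 1 2 * y 4 + quadCoeff f 2 2 * y 5

/-- The linear system of conics associated with the subspace `PG(L)` of `PG(5,q)`: the vector
space of the ternary quadratic forms whose corresponding hyperplane contains `PG(L)`.
It is a web if `PG(L)` is a line. -/
noncomputable def associatedSystem {F : Type*} [Field F] (L : Submodule F (Fin 6 → F)) :
    Submodule F (MvPolynomial (Fin 3) F) where
  carrier := {f | f.IsHomogeneous 2 ∧ ∀ y ∈ L, hyperplaneForm f y = 0}
  zero_mem' := ⟨MvPolynomial.isHomogeneous_zero _ _ _, fun y _ => by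
    simp [hyperplaneForm, quadCoeff]⟩
  add_mem' := by
    rintro f g ⟨hf, hf'⟩ ⟨hg, hg'⟩
    refine ⟨hf.add hg, fun y hy => ?_⟩
    have h1 := hf' y hy
    have h2 := hg' y hy
    simp only [hyperplaneForm, quadCoeff, MvPolynomial.coeff_add] at h1 h2 ⊢
    linear_combination h1 + h2
  smul_mem' := by
    rintro c f ⟨hf, hf'⟩
    refine ⟨(MvPolynomial.homogeneousSubmodule (Fin 3) F 2).smul_mem c hf, fun y hy => ?_⟩
    have h1 := hf' y hy
    simp only [hyperplaneForm, quadCoeff, MvPolynomial.coeff_smul, smul_eq_mul] at h1 ⊢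
    linear_combination c * h1

/-- `f₁, …, f₄` determine the web of conics associated with the line `PG(L)`: they form a basis
of the space of quadratic forms of that web. -/
def DetermineWeb {F : Type*} [Field F] (f : Fin 4 → MvPolynomial (Fin 3) F)
    (L : Submodule F (Fin 6 → F)) : Prop :=
  LinearIndependent F f ∧ Submodule.span F (Set.range f) = associatedSystem L

/-- The generic member `A f₁ + B f₂ + C f₃ + D f₄`, a ternary quadratic form over
`F[A, B, C, D]`. -/
noncomputable def genericMember {F : Type*} [Field F] (f : Fin 4 → MvPolynomial (Fin 3) F) :
    MvPolynomial (Fin 3) (MvPolynomial (Fin 4) F) :=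
  ∑ k, MvPolynomial.C (MvPolynomial.X k) * MvPolynomial.map MvPolynomial.C (f k)

/-- The zero locus of a form in `n` variables, a set of points of `PG(n-1,q)`. -/
def zeroLocus {F : Type*} [Field F] {n : ℕ} (g : MvPolynomial (Fin n) F) :
    Set (ℙ F (Fin n → F)) :=
  {P | MvPolynomial.eval P.rep g = 0}

/-- The cubic surface in `PG(3,q)` associated with the web determined by `f₁, …, f₄`: the zero
locus of the discriminant, a form in `F[A, B, C, D]`, of the generic member. -/
noncomputable def cubicSurface {F : Type*} [Field F] (f : Fin 4 → MvPolynomial (Fin 3) F) :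
    Set (ℙ F (Fin 4 → F)) :=
  zeroLocus (discr (genericMember f))

end VeroneseWeb

/-!
The whole statement follows from one identity: if the line `L` has `i` points of rank at most two,
then its cubic surface has `q² + iq + 1` points (`ncard_cubicSurface`). The equivalence is then
injectivity of `i ↦ q² + iq + 1`, and the possible values of `i` come from the determinant being a
binary cubic form on `L` (`ncard_points_inter_secantVariety`).

The identity is a double count that works in every characteristic. In projective terms, let `d` be
the number of double lines in the web, and `T` the number of pairs of a point `y` of `L` and a line
of the dual plane on which the symmetric bilinear form `M_y` vanishes identically.

* Over a finite field the discriminant of a form vanishes if and only if the form has a singular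
  point. A nonzero form with vanishing discriminant has one singular point, or `q + 1` if it is a
  double line (`card_isSingularAt`). Hence the number of pairs of a form of the web and a singular
  point of it is `N + qd`, where `N` is the number of points of the cubic surface.
* The forms singular at a point `v` make up a `3`-dimensional space. Its orthogonal complement
  consists of the symmetric matrices that are totally isotropic on the plane of linear forms
  vanishing at `v` (`dotOrth_singularForms`). By duality, the pairs above number `q² + q + 1 + qT`
  (`finrank_dotOrth_inf_singularForms`).
* For a nonzero symmetric matrix `M`, the number of points with `M(l,l) = 0` is `q + 1 + q(t - ε)`,
  where `t` is the number of totally isotropic lines and `ε` is `1` or `0` as `M` is singular or not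
  (`card_isotropic`). If `M` is singular with `r` in its kernel, this holds because `l ↦ r × l` maps
  isotropic vectors to the normals of the isotropic planes. Summing over `L` gives
  `(q + 1)² + q(T - i)`.
* The same sum counts, for each `l`, the points `y` of `L` with `M_y(l,l) = 0`: all `q + 1` of them
  if the double line `l²` lies in the web, and one otherwise. So it equals `q² + q + 1 + qd`.

The last two items give `T - d = i - 1`, and the first two `N = q² + q + 1 + q(T - d)`. The formal
count `card_coeffDiscr_eq_zero` uses vectors in place of points; `card_eq_one_add_mul_ncard`
translates between the two.
-/

namespace VeroneseWeb

open scoped Finset Classical Matrix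

/-! ### Vectors of a three-dimensional space -/

theorem exists_dotProduct_eq_one {F : Type*} [Field F] {v : Fin 3 → F} (hv : v ≠ 0) :
    ∃ u : Fin 3 → F, v ⬝ᵥ u = 1 := by
  obtain ⟨i, hi⟩ := Function.ne_iff.mp hv
  exact ⟨Pi.single i (v i)⁻¹, by simpa using mul_inv_cancel₀ hi⟩

theorem exists_smul_eq_of_cross_eq_zero {F : Type*} [Field F] {v w : Fin 3 → F} (hv : v ≠ 0)
    (h : crossProduct v w = 0) : ∃ t : F, w = t • v := by
  obtain ⟨u, hu⟩ := exists_dotProduct_eq_one hv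
  have h0 := congrFun h 0
  have h1 := congrFun h 1
  have h2 := congrFun h 2
  simp [cross_apply] at h0 h1 h2
  simp [dotProduct, Fin.sum_univ_three] at hu
  refine ⟨w ⬝ᵥ u, ?_⟩
  ext i
  fin_cases i <;> simp [dotProduct, Fin.sum_univ_three]
  · linear_combination (-w 0) * hu - u 1 * h2 + u 2 * h1
  · linear_combination (-w 1) * hu + u 0 * h2 - u 2 * h0
  · linear_combination (-w 2) * hu - u 0 * h1 + u 1 * h0

theorem card_multiples {F : Type*} [Field F] [Fintype F] {v : Fin 3 → F} (hv : v ≠ 0) :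
    #{x : Fin 3 → F | ∃ t : F, x = t • v} = Fintype.card F := by
  have : ({x : Fin 3 → F | ∃ t : F, x = t • v} : Finset (Fin 3 → F)) =
      Finset.univ.image (fun t : F => t • v) := by
    ext x; simp [eq_comm]
  rw [this, Finset.card_image_of_injective _ (smul_left_injective F hv), Finset.card_univ]

theorem card_nonzero_multiples {F : Type*} [Field F] [Fintype F] {v : Fin 3 → F} (hv : v ≠ 0) :
    #{x : Fin 3 → F | ∃ t : F, t ≠ 0 ∧ x = t • v} = Fintype.card F - 1 := by
  have : ({x : Fin 3 → F | ∃ t : F, t ≠ 0 ∧ x = t • v} : Finset (Fin 3 → F)) =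
      ({t : F | t ≠ 0} : Finset F).image (fun t : F => t • v) := by
    ext x; simp [eq_comm]
  rw [this, Finset.card_image_of_injective _ (smul_left_injective F hv), Finset.filter_ne',
    Finset.card_erase_of_mem (Finset.mem_univ _), Finset.card_univ]

theorem card_mul_card_ker {A B : Type*} [AddCommGroup A] [Fintype A] [AddCommGroup B] [Fintype B]
    (φ : A →+ B) (hφ : Function.Surjective φ) :
    #{x : A | φ x = 0} * Fintype.card B = Fintype.card A := by
  have h := φ.ker.card_mul_index
  rw [AddSubgroup.index_ker, AddMonoidHom.range_eq_top.mpr hφ, AddSubgroup.card_top] at h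
  simp only [Nat.card_eq_fintype_card] at h
  rw [← h, Fintype.card_subtype]
  simp only [AddMonoidHom.mem_ker]

theorem card_dotProduct_eq_zero {F : Type*} [Field F] [Fintype F] {v : Fin 3 → F} (hv : v ≠ 0) :
    #{x : Fin 3 → F | v ⬝ᵥ x = 0} = Fintype.card F ^ 2 := by
  obtain ⟨u, hu⟩ := exists_dotProduct_eq_one hv
  have h := card_mul_card_ker (A := Fin 3 → F) (B := F)
    { toFun := fun x => v ⬝ᵥ x
      map_zero' := by simp
      map_add' := fun x y => dotProduct_add v x y }
    (fun t => ⟨t • u, by simp [hu]⟩)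
  simp only [AddMonoidHom.coe_mk, ZeroHom.coe_mk, Fintype.card_pi, Finset.prod_const,
    Finset.card_univ, Fintype.card_fin] at h
  have hq : 0 < Fintype.card F := Fintype.card_pos
  exact Nat.eq_of_mul_eq_mul_right hq (by rw [h]; ring)

/-! ### Singular points of a plane conic -/

/-- The coefficients, in the order `X₀², X₀X₁, X₀X₂, X₁², X₁X₂, X₂²`, of the product of the two
linear forms with coefficient vectors `l` and `m`. -/
def prodForm {F : Type*} [Field F] (l m : Fin 3 → F) : Fin 6 → F :=
  ![l 0 * m 0, l 0 * m 1 + l 1 * m 0, l 0 * m 2 + l 2 * m 0, l 1 * m 1,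
    l 1 * m 2 + l 2 * m 1, l 2 * m 2]

/-- The value at `x` of the ternary quadratic form with coefficient vector `a`. -/
def evalForm {F : Type*} [Field F] (a : Fin 6 → F) (x : Fin 3 → F) : F :=
  a 0 * x 0 ^ 2 + a 1 * (x 0 * x 1) + a 2 * (x 0 * x 2) + a 3 * x 1 ^ 2 + a 4 * (x 1 * x 2)
    + a 5 * x 2 ^ 2

/-- The gradient at `x` of the ternary quadratic form with coefficient vector `a`. -/
def gradForm {F : Type*} [Field F] (a : Fin 6 → F) (x : Fin 3 → F) : Fin 3 → F :=
  ![2 * a 0 * x 0 + a 1 * x 1 + a 2 * x 2, a 1 * x 0 + 2 * a 3 * x 1 + a 4 * x 2,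
    a 2 * x 0 + a 4 * x 1 + 2 * a 5 * x 2]

/-- The discriminant in terms of the coefficient vector. -/
def coeffDiscr {F : Type*} [Field F] (a : Fin 6 → F) : F :=
  4 * a 0 * a 3 * a 5 + a 1 * a 2 * a 4 - a 0 * a 4 ^ 2 - a 3 * a 2 ^ 2 - a 5 * a 1 ^ 2

/-- The quadratic form `a` vanishes at `x` together with its gradient. In characteristic `2` the
first condition does not follow from the second. The zero vector is included. -/
def IsSingularAt {F : Type*} [Field F] (a : Fin 6 → F) (x : Fin 3 → F) : Prop :=
  evalForm a x = 0 ∧ gradForm a x = 0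

theorem gradForm_eq_zero_iff {F : Type*} [Field F] {a : Fin 6 → F} {x : Fin 3 → F} :
    gradForm a x = 0 ↔ 2 * a 0 * x 0 + a 1 * x 1 + a 2 * x 2 = 0 ∧
      a 1 * x 0 + 2 * a 3 * x 1 + a 4 * x 2 = 0 ∧ a 2 * x 0 + a 4 * x 1 + 2 * a 5 * x 2 = 0 := by
  simp [gradForm]

theorem isSingularAt_zero {F : Type*} [Field F] (a : Fin 6 → F) : IsSingularAt a 0 := by
  simp [IsSingularAt, gradForm_eq_zero_iff, evalForm]

theorem IsSingularAt.smul {F : Type*} [Field F] {a : Fin 6 → F} {x : Fin 3 → F}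
    (h : IsSingularAt a x) (t : F) : IsSingularAt a (t • x) := by
  obtain ⟨h0, h⟩ := h
  rw [gradForm_eq_zero_iff] at h
  obtain ⟨h1, h2, h3⟩ := h
  simp only [IsSingularAt, gradForm_eq_zero_iff, evalForm, Pi.smul_apply, smul_eq_mul] at *
  refine ⟨by linear_combination t ^ 2 * h0, by linear_combination t * h1,
    by linear_combination t * h2, by linear_combination t * h3⟩

theorem evalForm_add {F : Type*} [Field F] (a : Fin 6 → F) (x y : Fin 3 → F) :
    evalForm a (x + y) = evalForm a x + evalForm a y + gradForm a x ⬝ᵥ y := by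
  simp [evalForm, gradForm, dotProduct, Fin.sum_univ_three]
  ring

theorem evalForm_smul {F : Type*} [Field F] (a : Fin 6 → F) (t : F) (x : Fin 3 → F) :
    evalForm a (t • x) = t ^ 2 * evalForm a x := by
  simp [evalForm]
  ring

theorem IsSingularAt.evalForm_add_left {F : Type*} [Field F] {a : Fin 6 → F} {x : Fin 3 → F}
    (h : IsSingularAt a x) (y : Fin 3 → F) : evalForm a (x + y) = evalForm a y := by
  rw [evalForm_add, h.1, h.2]; simp

theorem evalForm_prodForm {F : Type*} [Field F] (c : F) (l x : Fin 3 → F) :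
    evalForm (c • prodForm l l) x = c * (l ⬝ᵥ x) ^ 2 := by
  simp [evalForm, prodForm, dotProduct, Fin.sum_univ_three]
  ring

/-- The values of a ternary quadratic form determine its coefficients, over every field. -/
theorem evalForm_injective {F : Type*} [Field F] {a b : Fin 6 → F}
    (h : ∀ x, evalForm a x = evalForm b x) : a = b := by
  have h0 := h ![1, 0, 0]
  have h1 := h ![0, 1, 0]
  have h2 := h ![0, 0, 1]
  have h3 := h ![1, 1, 0]
  have h4 := h ![1, 0, 1]
  have h5 := h ![0, 1, 1]
  simp [evalForm] at h0 h1 h2 h3 h4 h5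
  ext i
  fin_cases i <;> simp
  · exact h0
  · linear_combination h3 - h0 - h1
  · linear_combination h4 - h0 - h2
  · exact h1
  · linear_combination h5 - h1 - h2
  · exact h2

theorem coeffDiscr_eq_zero_of_isSingularAt {F : Type*} [Field F] {a : Fin 6 → F} {x : Fin 3 → F}
    (h : IsSingularAt a x) (hx : x ≠ 0) : coeffDiscr a = 0 := by
  obtain ⟨i, hi⟩ := Function.ne_iff.mp hx
  have h' := h.smul (x i)⁻¹
  have hi' : ((x i)⁻¹ • x) i = 1 := by simpa using inv_mul_cancel₀ hi
  generalize (x i)⁻¹ • x = y at h' hi'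
  obtain ⟨h0, h⟩ := h'
  rw [gradForm_eq_zero_iff] at h
  obtain ⟨h1, h2, h3⟩ := h
  simp only [evalForm, coeffDiscr] at *
  clear h hi hx
  fin_cases i <;> simp at hi'
  all_goals rw [hi'] at h0 h1 h2 h3
  · have e1 : a 1 = -(2 * a 3 * y 1 + a 4 * y 2) := by linear_combination h2
    have e2 : a 2 = -(a 4 * y 1 + 2 * a 5 * y 2) := by linear_combination h3
    have e0 : a 0 =
        -(a 1 * y 1 + a 2 * y 2 + a 3 * y 1 ^ 2 + a 4 * (y 1 * y 2) + a 5 * y 2 ^ 2) := by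
      linear_combination h0
    rw [e0, e1, e2]; ring
  · have e1 : a 1 = -(2 * a 0 * y 0 + a 2 * y 2) := by linear_combination h1
    have e2 : a 4 = -(a 2 * y 0 + 2 * a 5 * y 2) := by linear_combination h3
    have e0 : a 3 =
        -(a 1 * y 0 + a 4 * y 2 + a 0 * y 0 ^ 2 + a 2 * (y 0 * y 2) + a 5 * y 2 ^ 2) := by
      linear_combination h0
    rw [e0, e1, e2]; ring
  · have e1 : a 2 = -(2 * a 0 * y 0 + a 1 * y 1) := by linear_combination h1
    have e2 : a 4 = -(a 1 * y 0 + 2 * a 3 * y 1) := by linear_combination h2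
    have e0 : a 5 =
        -(a 2 * y 0 + a 4 * y 1 + a 0 * y 0 ^ 2 + a 1 * (y 0 * y 1) + a 3 * y 1 ^ 2) := by
      linear_combination h0
    rw [e0, e1, e2]; ring

theorem exists_ne_zero_dotProduct_eq_zero {F : Type*} [Field F] (l : Fin 3 → F) :
    ∃ x : Fin 3 → F, x ≠ 0 ∧ l ⬝ᵥ x = 0 := by
  by_cases h : l 0 = 0
  · exact ⟨![1, 0, 0], by simp, by simp [dotProduct, Fin.sum_univ_three, h]⟩
  · exact ⟨![-l 1, l 0, 0], fun h' => h (by simpa using congrFun h' 1), by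
      simp [dotProduct, Fin.sum_univ_three]; ring⟩

/-- In characteristic two the existence of a singular vector uses that the field is perfect: if
the polar form vanishes, the form is diagonal and its coefficients are squares. -/
theorem exists_isSingularAt {F : Type*} [Field F] [Fintype F] {a : Fin 6 → F}
    (h : coeffDiscr a = 0) : ∃ x, x ≠ 0 ∧ IsSingularAt a x := by
  by_cases h2 : (2 : F) = 0
  · have h4 : (4 : F) = 0 := by linear_combination 2 * h2
    have hc : CharP F 2 := CharTwo.of_one_ne_zero_of_two_eq_zero one_ne_zero h2
    by_cases hn : (![a 4, a 2, a 1] : Fin 3 → F) = 0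
    · -- A diagonal form in characteristic two is the square of a linear form.
      simp at hn
      obtain ⟨n4, n2, n1⟩ := hn
      have hs : ∀ t : F, ∃ s, s ^ 2 = t := fun t => by
        obtain ⟨s, hs⟩ := FiniteField.isSquare_of_char_two (ringChar.eq F 2) t
        exact ⟨s, by rw [hs]; ring⟩
      obtain ⟨s0, e0⟩ := hs (a 0)
      obtain ⟨s1, e1⟩ := hs (a 3)
      obtain ⟨s2, e2⟩ := hs (a 5)
      obtain ⟨x, hx, hx0⟩ := exists_ne_zero_dotProduct_eq_zero ![s0, s1, s2]
      refine ⟨x, hx, ?_, gradForm_eq_zero_iff.mpr ?_⟩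
      · simp [dotProduct, Fin.sum_univ_three] at hx0
        simp only [evalForm, n1, n2, n4, ← e0, ← e1, ← e2]
        linear_combination (s0 * x 0 + s1 * x 1 + s2 * x 2) * hx0 -
          (s0 * x 0 * s1 * x 1 + s0 * x 0 * s2 * x 2 + s1 * x 1 * s2 * x 2) * h2
      · simp [h2, n1, n2, n4]
    · -- The radical of the polar form, which is alternating, is spanned by `(a₁₂, a₀₂, a₀₁)`.
      refine ⟨_, hn, ?_, gradForm_eq_zero_iff.mpr ?_⟩
      · simp [coeffDiscr] at h
        simp [evalForm]
        linear_combination h + (a 0 * a 4 ^ 2 + a 3 * a 2 ^ 2 + a 5 * a 1 ^ 2 + a 1 * a 2 * a 4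
          - 2 * a 0 * a 3 * a 5) * h2
      · simp
        refine ⟨?_, ?_, ?_⟩
        · linear_combination (a 0 * a 4 + a 1 * a 2) * h2
        · linear_combination (a 3 * a 2 + a 1 * a 4) * h2
        · linear_combination (a 5 * a 1 + a 2 * a 4) * h2
  · have hd : (!![2 * a 0, a 1, a 2; a 1, 2 * a 3, a 4; a 2, a 4, 2 * a 5]).det = 0 := by
      rw [Matrix.det_fin_three]
      simp [coeffDiscr] at h ⊢
      linear_combination 2 * h
    obtain ⟨x, hx, hx0⟩ := Matrix.exists_mulVec_eq_zero_iff.mpr hd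
    have h0 := congrFun hx0 0
    have h1 := congrFun hx0 1
    have h3 := congrFun hx0 2
    simp [Matrix.mulVec, dotProduct, Fin.sum_univ_three] at h0 h1 h3
    refine ⟨x, hx, ?_, gradForm_eq_zero_iff.mpr ⟨h0, h1, h3⟩⟩
    apply mul_left_cancel₀ h2
    simp only [evalForm]
    linear_combination x 0 * h0 + x 1 * h1 + x 2 * h3

/-- A quadratic form singular along a line is a multiple of the square of the equation of that
line. -/
theorem eq_smul_prodForm_of_isSingularAt {F : Type*} [Field F] {a : Fin 6 → F} {v w : Fin 3 → F}
    (hv : IsSingularAt a v) (hw : IsSingularAt a w) (h : crossProduct v w ≠ 0) :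
    ∃ c : F, a = c • prodForm (crossProduct v w) (crossProduct v w) := by
  obtain ⟨u, hu⟩ := exists_dotProduct_eq_one h
  refine ⟨evalForm a u, evalForm_injective fun x => ?_⟩
  rw [evalForm_prodForm]
  -- `x` lies in the coset of `(l ⬝ᵥ x) • u` modulo the span of `v` and `w`.
  have hx : x = (-(crossProduct x u ⬝ᵥ w)) • v + ((crossProduct x u ⬝ᵥ v) • w
      + (crossProduct v w ⬝ᵥ x) • u) := by
    simp [cross_apply, dotProduct, Fin.sum_univ_three] at hu ⊢
    ext i
    fin_cases i <;> simp
    · linear_combination (-x 0) * hu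
    · linear_combination (-x 1) * hu
    · linear_combination (-x 2) * hu
  conv_lhs => rw [hx]
  rw [(hv.smul _).evalForm_add_left, (hw.smul _).evalForm_add_left, evalForm_smul]
  ring

theorem isSingularAt_smul_prodForm {F : Type*} [Field F] {c : F} (hc : c ≠ 0)
    (l x : Fin 3 → F) : IsSingularAt (c • prodForm l l) x ↔ l ⬝ᵥ x = 0 := by
  constructor
  · rintro ⟨h, -⟩
    rw [evalForm_prodForm] at h
    simpa [hc] using h
  · intro h
    refine ⟨by rw [evalForm_prodForm, h]; ring, gradForm_eq_zero_iff.mpr ?_⟩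
    simp [prodForm, dotProduct, Fin.sum_univ_three] at h ⊢
    refine ⟨?_, ?_, ?_⟩
    · linear_combination 2 * c * l 0 * h
    · linear_combination 2 * c * l 1 * h
    · linear_combination 2 * c * l 2 * h

/-- The number of singular vectors of a nonzero quadratic form. Up to scalars, the singular
points are none, one, or the points of a line, the last if the form is a multiple of the square
of a linear form. -/
theorem card_isSingularAt {F : Type*} [Field F] [Fintype F] {a : Fin 6 → F} (ha : a ≠ 0) :
    (#{x : Fin 3 → F | IsSingularAt a x} : ℤ) =
      1 + ((Fintype.card F : ℤ) - 1) * (if coeffDiscr a = 0 then 1 else 0)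
        + Fintype.card F * #{l : Fin 3 → F | ∃ c : F, a = c • prodForm l l} := by
  have hq : 1 ≤ Fintype.card F := Fintype.card_pos
  by_cases hE : ∃ l : Fin 3 → F, ∃ c : F, a = c • prodForm l l
  · obtain ⟨l, c, rfl⟩ := hE
    have hc : c ≠ 0 := by rintro rfl; simp at ha
    have hl : l ≠ 0 := by
      rintro rfl; apply ha; ext i; fin_cases i <;> simp [prodForm]
    have hd : coeffDiscr (c • prodForm l l) = 0 := by
      simp [coeffDiscr, prodForm]; ring
    have hE : ({m : Fin 3 → F | ∃ c' : F, c • prodForm l l = c' • prodForm m m} :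
        Finset (Fin 3 → F)) =
        ({m : Fin 3 → F | ∃ t : F, t ≠ 0 ∧ m = t • l} : Finset (Fin 3 → F)) := by
      ext m
      simp only [Finset.mem_filter, Finset.mem_univ, true_and]
      constructor
      · rintro ⟨c', h⟩
        have hc' : c' ≠ 0 := by rintro rfl; simp at h; exact ha (by simp [h])
        have hm : m ≠ 0 := by
          rintro rfl; apply ha; rw [h]; ext i; fin_cases i <;> simp [prodForm]
        have key : ∀ x, l ⬝ᵥ x = 0 → m ⬝ᵥ x = 0 := fun x hx => by
          rwa [← isSingularAt_smul_prodForm hc', ← h, isSingularAt_smul_prodForm hc]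
        have hcr : crossProduct l m = 0 := by
          rw [← dotProduct_eq_zero_iff]
          intro z
          have := key (crossProduct l z) (by simp)
          rw [triple_product_permutation, triple_product_permutation, ← cross_anticomm l m] at this
          rwa [dotProduct_neg, neg_eq_zero, dotProduct_comm] at this
        obtain ⟨t, rfl⟩ := exists_smul_eq_of_cross_eq_zero hl hcr
        exact ⟨t, by rintro rfl; simp at hm, rfl⟩
      · rintro ⟨t, ht, rfl⟩
        refine ⟨c * (t ^ 2)⁻¹, ?_⟩
        ext i; fin_cases i <;> simp [prodForm] <;> field_simp
    simp only [isSingularAt_smul_prodForm hc, hd, if_true]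
    rw [hE, card_nonzero_multiples hl, card_dotProduct_eq_zero hl]
    push_cast [hq]
    ring
  · have hE0 : ({l : Fin 3 → F | ∃ c : F, a = c • prodForm l l} : Finset (Fin 3 → F)) = ∅ := by
      ext l; simpa using fun c hc => hE ⟨l, c, hc⟩
    rw [hE0]
    by_cases hd : coeffDiscr a = 0
    · obtain ⟨v, hv, hs⟩ := exists_isSingularAt hd
      have : ({x : Fin 3 → F | IsSingularAt a x} : Finset (Fin 3 → F)) =
          ({x : Fin 3 → F | ∃ t : F, x = t • v} : Finset (Fin 3 → F)) := by
        ext x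
        simp only [Finset.mem_filter, Finset.mem_univ, true_and]
        constructor
        · intro hx
          apply exists_smul_eq_of_cross_eq_zero hv
          by_contra hne
          exact hE ⟨_, eq_smul_prodForm_of_isSingularAt hs hx hne⟩
        · rintro ⟨t, rfl⟩
          exact hs.smul t
      rw [this, card_multiples hv]
      simp [hd]
    · have : ({x : Fin 3 → F | IsSingularAt a x} : Finset (Fin 3 → F)) = {0} := by
        ext x
        simp only [Finset.mem_filter, Finset.mem_univ, true_and, Finset.mem_singleton]
        constructor
        · intro hx
          by_contra hne
          exact hd (coeffDiscr_eq_zero_of_isSingularAt hx hne)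
        · rintro rfl
          exact isSingularAt_zero a
      rw [this]
      simp [hd]

/-! ### Isotropic vectors and lines of a symmetric matrix -/

/-- The symmetric bilinear form with matrix `symMatrix y`. -/
def bil {F : Type*} [Field F] (y : Fin 6 → F) (l m : Fin 3 → F) : F :=
  y ⬝ᵥ prodForm l m

/-- `bil y` vanishes identically on the orthogonal complement of `v`, which for `v ≠ 0` consists
of the vectors `v × a`. The zero vector satisfies the condition. -/
def IsIsotropicNormal {F : Type*} [Field F] (y : Fin 6 → F) (v : Fin 3 → F) : Prop :=
  ∀ a b, bil y (crossProduct v a) (crossProduct v b) = 0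

theorem bil_eq {F : Type*} [Field F] (y : Fin 6 → F) (l m : Fin 3 → F) :
    bil y l m = l ⬝ᵥ (symMatrix y *ᵥ m) := by
  simp [bil, prodForm, symMatrix, dotProduct, Matrix.mulVec, Fin.sum_univ_six,
    Fin.sum_univ_three]
  ring

theorem bil_comm {F : Type*} [Field F] (y : Fin 6 → F) (l m : Fin 3 → F) :
    bil y l m = bil y m l := by
  simp [bil, prodForm, dotProduct, Fin.sum_univ_six]
  ring

theorem bil_add_left {F : Type*} [Field F] (y : Fin 6 → F) (l l' m : Fin 3 → F) :
    bil y (l + l') m = bil y l m + bil y l' m := by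
  simp [bil_eq, add_dotProduct]

theorem bil_add_right {F : Type*} [Field F] (y : Fin 6 → F) (l m m' : Fin 3 → F) :
    bil y l (m + m') = bil y l m + bil y l m' := by
  simp [bil_eq, Matrix.mulVec_add, dotProduct_add]

theorem bil_smul_left {F : Type*} [Field F] (y : Fin 6 → F) (t : F) (l m : Fin 3 → F) :
    bil y (t • l) m = t * bil y l m := by
  simp [bil_eq]

theorem bil_smul_right {F : Type*} [Field F] (y : Fin 6 → F) (t : F) (l m : Fin 3 → F) :
    bil y l (t • m) = t * bil y l m := by
  simp [bil_eq, Matrix.mulVec_smul]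

theorem bil_sub_left {F : Type*} [Field F] (y : Fin 6 → F) (l l' m : Fin 3 → F) :
    bil y (l - l') m = bil y l m - bil y l' m := by
  simp [bil_eq, sub_dotProduct]

theorem bil_sub_right {F : Type*} [Field F] (y : Fin 6 → F) (l m m' : Fin 3 → F) :
    bil y l (m - m') = bil y l m - bil y l m' := by
  simp [bil_eq, Matrix.mulVec_sub, dotProduct_sub]

theorem eq_zero_of_bil_eq_zero {F : Type*} [Field F] {y : Fin 6 → F}
    (h : ∀ l m, bil y l m = 0) : y = 0 := by
  have h0 := h ![1, 0, 0] ![1, 0, 0]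
  have h1 := h ![1, 0, 0] ![0, 1, 0]
  have h2 := h ![1, 0, 0] ![0, 0, 1]
  have h3 := h ![0, 1, 0] ![0, 1, 0]
  have h4 := h ![0, 1, 0] ![0, 0, 1]
  have h5 := h ![0, 0, 1] ![0, 0, 1]
  simp [bil, prodForm, dotProduct, Fin.sum_univ_six] at h0 h1 h2 h3 h4 h5
  ext i
  fin_cases i <;> simp [*]

theorem bil_eq_zero_of_mulVec_eq_zero {F : Type*} [Field F] {y : Fin 6 → F} {r : Fin 3 → F}
    (h : symMatrix y *ᵥ r = 0) (l : Fin 3 → F) : bil y l r = 0 := by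
  rw [bil_eq, h, dotProduct_zero]

theorem bil_zero_left {F : Type*} [Field F] (y : Fin 6 → F) (m : Fin 3 → F) :
    bil y 0 m = 0 := by
  simp [bil_eq]

theorem isIsotropicNormal_zero {F : Type*} [Field F] (y : Fin 6 → F) :
    IsIsotropicNormal y 0 := fun a b => by simp [bil_zero_left]

/-- Two orthogonal isotropic vectors span a totally isotropic plane. -/
theorem isIsotropicNormal_cross {F : Type*} [Field F] {y : Fin 6 → F} {r l : Fin 3 → F}
    (hr : bil y r r = 0) (hl : bil y l l = 0) (hrl : bil y r l = 0) :
    IsIsotropicNormal y (crossProduct r l) := by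
  intro a b
  have hlr : bil y l r = 0 := by rw [bil_comm, hrl]
  have h : ∀ a : Fin 3 → F, crossProduct (crossProduct r l) a = (r ⬝ᵥ a) • l - (l ⬝ᵥ a) • r := by
    intro a
    ext i
    fin_cases i <;> simp [cross_apply, dotProduct, Fin.sum_univ_three] <;> ring
  simp [h, bil_sub_left, bil_sub_right, bil_smul_left, bil_smul_right, hr, hl, hrl, hlr]

theorem IsIsotropicNormal.dotProduct_eq_zero {F : Type*} [Field F] {y : Fin 6 → F}
    {v r : Fin 3 → F} (h : IsIsotropicNormal y v) (hy : y ≠ 0) (hr : symMatrix y *ᵥ r = 0) :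
    r ⬝ᵥ v = 0 := by
  by_contra hne
  have e : ∀ a : Fin 3 → F,
      crossProduct v (crossProduct a r) = (r ⬝ᵥ v) • a - (v ⬝ᵥ a) • r := by
    intro a
    ext i
    fin_cases i <;> simp [cross_apply, dotProduct, Fin.sum_univ_three] <;> ring
  have hrl : ∀ l, bil y r l = 0 := fun l => by
    rw [bil_comm, bil_eq_zero_of_mulVec_eq_zero hr]
  refine hy (eq_zero_of_bil_eq_zero fun l m => ?_)
  have := h (crossProduct l r) (crossProduct m r)
  simpa [e, bil_sub_left, bil_sub_right, bil_smul_left, bil_smul_right, hrl,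
    bil_eq_zero_of_mulVec_eq_zero hr, hne] using this

/-- For a nonzero singular symmetric matrix with a vector `r` in its kernel, `l ↦ r × l` maps the
isotropic vectors onto the normals of the totally isotropic planes, all of which contain `r`; its
fibres are cosets of the line spanned by `r`. -/
theorem card_isotropic_of_det_eq_zero {F : Type*} [Field F] [Fintype F] {y : Fin 6 → F}
    (hy : y ≠ 0) (hd : (symMatrix y).det = 0) :
    #{l : Fin 3 → F | bil y l l = 0} =
      Fintype.card F * #{v : Fin 3 → F | IsIsotropicNormal y v} := by
  obtain ⟨r, hr, hr0⟩ := Matrix.exists_mulVec_eq_zero_iff.mpr hd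
  obtain ⟨u, hu⟩ := exists_dotProduct_eq_one hr
  have hlr := bil_eq_zero_of_mulVec_eq_zero hr0
  have hrl : ∀ l, bil y r l = 0 := fun l => by rw [bil_comm, hlr]
  rw [mul_comm, ← Finset.card_univ, ← Finset.card_product]
  refine Finset.card_nbij' (fun l => (crossProduct r l, u ⬝ᵥ l))
    (fun p => crossProduct p.1 u + p.2 • r) ?_ ?_ ?_ ?_
  · intro l hl
    simp only [Finset.coe_filter, Finset.mem_univ, true_and, Set.mem_ofPred_eq] at hl
    simp only [Finset.coe_product, Finset.coe_filter, Finset.coe_univ, Set.mem_prod,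
      Finset.mem_univ, true_and, Set.mem_ofPred_eq, Set.mem_univ, and_true]
    exact isIsotropicNormal_cross (hrl r) hl (hrl l)
  · rintro ⟨v, s⟩ hv
    simp only [Finset.coe_product, Finset.coe_filter, Finset.coe_univ, Set.mem_prod,
      Finset.mem_univ, true_and, Set.mem_ofPred_eq, Set.mem_univ, and_true] at hv
    simp only [Finset.coe_filter, Finset.mem_univ, true_and, Set.mem_ofPred_eq]
    simp [bil_add_left, bil_add_right, bil_smul_left, bil_smul_right, hrl, hlr, hv u u]
  · intro l _
    simp [dotProduct, Fin.sum_univ_three] at hu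
    ext i
    fin_cases i <;> simp [cross_apply, dotProduct, Fin.sum_univ_three]
    · linear_combination l 0 * hu
    · linear_combination l 1 * hu
    · linear_combination l 2 * hu
  · rintro ⟨v, s⟩ hv
    simp only [Finset.coe_product, Finset.coe_filter, Finset.coe_univ, Set.mem_prod,
      Finset.mem_univ, true_and, Set.mem_ofPred_eq, Set.mem_univ, and_true] at hv
    have hrv := hv.dotProduct_eq_zero hy hr0
    simp [dotProduct, Fin.sum_univ_three] at hu hrv
    refine Prod.ext ?_ ?_
    · ext i
      fin_cases i <;> simp [cross_apply, Matrix.vecHead, Matrix.vecTail]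
      · linear_combination v 0 * hu - u 0 * hrv
      · linear_combination v 1 * hu - u 1 * hrv
      · linear_combination v 2 * hu - u 2 * hrv
    · simp [cross_apply, dotProduct, Fin.sum_univ_three]
      linear_combination s * hu

/-- A nonsingular symmetric matrix of size three has no totally isotropic plane. -/
theorem IsIsotropicNormal.eq_zero {F : Type*} [Field F] {y : Fin 6 → F} {v : Fin 3 → F}
    (h : IsIsotropicNormal y v) (hd : (symMatrix y).det ≠ 0) : v = 0 := by
  by_contra hv
  -- The plane orthogonal to `v` is isotropic and meets the plane `bil y u x = 0` in a nonzero `x`.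
  -- As `u` spans a complement of the first plane, `x` lies in the kernel of the matrix.
  obtain ⟨u, hu⟩ := exists_dotProduct_eq_one hv
  obtain ⟨x, hx, hvx, hux⟩ : ∃ x : Fin 3 → F, x ≠ 0 ∧ v ⬝ᵥ x = 0 ∧ bil y u x = 0 := by
    by_cases hc : crossProduct v (symMatrix y *ᵥ u) = 0
    · obtain ⟨t, ht⟩ := exists_smul_eq_of_cross_eq_zero hv hc
      obtain ⟨x, hx, hx0⟩ := exists_ne_zero_dotProduct_eq_zero v
      refine ⟨x, hx, hx0, ?_⟩
      rw [bil_comm, bil_eq, ht, dotProduct_smul, dotProduct_comm, hx0, smul_zero]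
    · refine ⟨_, hc, by simp, ?_⟩
      rw [bil_comm, bil_eq, dotProduct_comm]
      simp
  have hp : ∀ z : Fin 3 → F, v ⬝ᵥ z = 0 → z = crossProduct v (crossProduct z u) := by
    intro z hz
    simp [dotProduct, Fin.sum_univ_three] at hu hz
    ext i
    fin_cases i <;> simp [cross_apply]
    · linear_combination (-z 0) * hu + u 0 * hz
    · linear_combination (-z 1) * hu + u 1 * hz
    · linear_combination (-z 2) * hu + u 2 * hz
  refine hd (Matrix.exists_mulVec_eq_zero_iff.mp ⟨x, hx, ?_⟩)
  rw [← dotProduct_eq_zero_iff]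
  intro z
  rw [dotProduct_comm, ← bil_eq]
  have hz : z = (v ⬝ᵥ z) • u + (z - (v ⬝ᵥ z) • u) := by abel
  have hz0 : v ⬝ᵥ (z - (v ⬝ᵥ z) • u) = 0 := by simp [dotProduct_sub, hu]
  rw [hz, bil_add_left, bil_smul_left, hux, hp _ hz0, hp _ hvx, h]
  simp

theorem card_isIsotropicNormal_of_det_ne_zero {F : Type*} [Field F] [Fintype F] {y : Fin 6 → F}
    (hd : (symMatrix y).det ≠ 0) : #{v : Fin 3 → F | IsIsotropicNormal y v} = 1 := by
  rw [Finset.card_eq_one]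
  refine ⟨0, ?_⟩
  ext v
  simp only [Finset.mem_filter, Finset.mem_univ, true_and, Finset.mem_singleton]
  exact ⟨fun h => h.eq_zero hd, by rintro rfl; exact isIsotropicNormal_zero y⟩

/-- An instance of the Chevalley–Warning theorem. -/
theorem exists_isotropic {F : Type*} [Field F] [Fintype F] (y : Fin 6 → F) :
    ∃ l : Fin 3 → F, l ≠ 0 ∧ bil y l l = 0 := by
  obtain ⟨p, hp⟩ := CharP.exists F
  have hprime : p.Prime := CharP.char_is_prime F p
  let f : MvPolynomial (Fin 3) F :=
    ∑ i, ∑ j, MvPolynomial.C (symMatrix y i j) * (MvPolynomial.X i * MvPolynomial.X j)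
  have hf : f.totalDegree < Fintype.card (Fin 3) := by
    have : f.IsHomogeneous 2 := by
      refine MvPolynomial.IsHomogeneous.sum _ _ _ fun i _ =>
        MvPolynomial.IsHomogeneous.sum _ _ _ fun j _ => ?_
      have h := (MvPolynomial.isHomogeneous_C (Fin 3) (symMatrix y i j)).mul
        ((MvPolynomial.isHomogeneous_X F i).mul (MvPolynomial.isHomogeneous_X F j))
      simpa using h
    exact lt_of_le_of_lt this.totalDegree_le (by simp)
  have he : ∀ x, MvPolynomial.eval x f = bil y x x := by
    intro x
    simp [f, bil_eq, dotProduct, Matrix.mulVec, Finset.mul_sum]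
    refine Finset.sum_congr rfl fun i _ => Finset.sum_congr rfl fun j _ => ?_
    ring
  have hdvd := char_dvd_card_solutions p hf
  simp only [he] at hdvd
  by_contra! hne
  have : Fintype.card {x : Fin 3 → F // bil y x x = 0} = 1 := by
    rw [Fintype.card_eq_one_iff]
    refine ⟨⟨0, bil_zero_left y 0⟩, fun x => Subtype.ext ?_⟩
    by_contra hx
    exact hne x hx x.2
  rw [this] at hdvd
  exact hprime.one_lt.ne' (Nat.dvd_one.mp hdvd)

/-- A nonsingular conic has `q + 1` points; in characteristic two the isotropic vectors instead
form a plane. In both cases the number of isotropic vectors is `q²`. -/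
theorem card_isotropic_of_det_ne_zero {F : Type*} [Field F] [Fintype F] {y : Fin 6 → F}
    (hd : (symMatrix y).det ≠ 0) :
    #{l : Fin 3 → F | bil y l l = 0} = Fintype.card F ^ 2 := by
  have hq : 0 < Fintype.card F := Fintype.card_pos
  have hcard : Fintype.card (Fin 3 → F) = Fintype.card F ^ 3 := by simp
  by_cases h2 : (2 : F) = 0
  · have hc : CharP F 2 := CharTwo.of_one_ne_zero_of_two_eq_zero one_ne_zero h2
    have hn : ∃ l : Fin 3 → F, bil y l l ≠ 0 := by
      by_contra! h
      have h0 := h ![1, 0, 0]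
      have h1 := h ![0, 1, 0]
      have h3 := h ![0, 0, 1]
      simp [bil, prodForm, dotProduct, Fin.sum_univ_six] at h0 h1 h3
      refine hd ?_
      rw [Matrix.det_fin_three]
      simp [symMatrix, h0, h1, h3]
      linear_combination y 1 * y 2 * y 4 * h2
    obtain ⟨l, hl⟩ := hn
    have h := card_mul_card_ker (A := Fin 3 → F) (B := F)
      { toFun := fun x => bil y x x
        map_zero' := bil_zero_left y 0
        map_add' := fun x z => by
          simp only [bil_add_left, bil_add_right, bil_comm y z x]
          linear_combination bil y x z * h2 }
      (fun t => by
        obtain ⟨s, hs⟩ := FiniteField.isSquare_of_char_two (ringChar.eq F 2) (t / bil y l l)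
        refine ⟨s • l, ?_⟩
        simp only [AddMonoidHom.coe_mk, ZeroHom.coe_mk, bil_smul_left, bil_smul_right]
        rw [← mul_assoc, ← hs, div_mul_cancel₀ _ hl])
    simp only [AddMonoidHom.coe_mk, ZeroHom.coe_mk, hcard] at h
    exact Nat.eq_of_mul_eq_mul_right hq (by rw [h]; ring)
  · obtain ⟨r, hr, hr0⟩ := exists_isotropic y
    -- The tangent plane at `r` contains no isotropic vectors other than the multiples of `r`;
    -- every line through `r` not in that plane contains exactly one further isotropic point.
    have hw : symMatrix y *ᵥ r ≠ 0 := fun h =>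
      hd (Matrix.exists_mulVec_eq_zero_iff.mp ⟨r, hr, h⟩)
    have htan : #{l : Fin 3 → F | bil y l r = 0} = Fintype.card F ^ 2 := by
      rw [← card_dotProduct_eq_zero hw]
      simp only [bil_eq, dotProduct_comm]
    have h1 : ({l : Fin 3 → F | bil y l l = 0 ∧ bil y l r = 0} : Finset (Fin 3 → F)) =
        ({l : Fin 3 → F | ∃ t : F, l = t • r} : Finset (Fin 3 → F)) := by
      ext l
      simp only [Finset.mem_filter, Finset.mem_univ, true_and]
      constructor
      · rintro ⟨hl, hlr⟩
        exact exists_smul_eq_of_cross_eq_zero hr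
          ((isIsotropicNormal_cross hr0 hl (by rw [bil_comm, hlr])).eq_zero hd)
      · rintro ⟨t, rfl⟩
        simp [bil_smul_left, bil_smul_right, hr0]
    have h3 : #{l : Fin 3 → F | bil y l r ≠ 0} =
        #{l : Fin 3 → F | bil y l l = 0 ∧ bil y l r ≠ 0} * Fintype.card F := by
      rw [← Finset.card_univ (α := F), ← Finset.card_product]
      refine Finset.card_nbij'
        (fun l => (l - (bil y l l / (2 * bil y l r)) • r, bil y l l / (2 * bil y l r)))
        (fun p => p.1 + p.2 • r) ?_ ?_ ?_ ?_
      · intro l hl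
        simp only [Finset.coe_filter, Finset.mem_univ, true_and, Set.mem_ofPred_eq] at hl
        simp only [Finset.coe_product, Finset.coe_filter, Finset.coe_univ, Set.mem_prod,
          Finset.mem_univ, true_and, Set.mem_ofPred_eq, Set.mem_univ, and_true]
        simp only [bil_sub_left, bil_sub_right, bil_smul_left, bil_smul_right, hr0,
          bil_comm y r l]
        refine ⟨by field_simp; ring, by simpa using hl⟩
      · rintro ⟨l, s⟩ hl
        simp only [Finset.coe_product, Finset.coe_filter, Finset.coe_univ, Set.mem_prod,
          Finset.mem_univ, true_and, Set.mem_ofPred_eq, Set.mem_univ, and_true] at hl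
        simp only [Finset.coe_filter, Finset.mem_univ, true_and, Set.mem_ofPred_eq]
        simpa [bil_add_left, bil_smul_left, hr0] using hl.2
      · intro l _
        simp
      · rintro ⟨l, s⟩ hl
        simp only [Finset.coe_product, Finset.coe_filter, Finset.coe_univ, Set.mem_prod,
          Finset.mem_univ, true_and, Set.mem_ofPred_eq, Set.mem_univ, and_true] at hl
        obtain ⟨hl, hlr⟩ := hl
        have : bil y (l + s • r) (l + s • r) / (2 * bil y (l + s • r) r) = s := by
          simp only [bil_add_left, bil_add_right, bil_smul_left, bil_smul_right, hr0,
            bil_comm y r l, hl, mul_zero, add_zero, zero_add]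
          field_simp
          ring
        simp [this]
    have h4 := Finset.card_filter_add_card_filter_not (s := (Finset.univ : Finset (Fin 3 → F)))
      (fun l => bil y l r = 0)
    have h5 := Finset.card_filter_add_card_filter_not
      (s := ({l : Fin 3 → F | bil y l l = 0} : Finset (Fin 3 → F))) (fun l => bil y l r = 0)
    rw [Finset.filter_filter, Finset.filter_filter, h1, card_multiples hr] at h5
    rw [htan, Finset.card_univ, hcard] at h4
    have h3' : #{l : Fin 3 → F | ¬ bil y l r = 0} =
        #{l : Fin 3 → F | bil y l l = 0 ∧ ¬ bil y l r = 0} * Fintype.card F := h3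
    rw [← h5]
    apply Nat.eq_of_mul_eq_mul_right hq
    nlinarith

/-- The number of isotropic vectors in terms of the number of normals of totally isotropic planes,
in every characteristic. The last term corrects the formula for the zero matrix. -/
theorem card_isotropic {F : Type*} [Field F] [Fintype F] (y : Fin 6 → F) :
    (#{l : Fin 3 → F | bil y l l = 0} : ℤ) =
      Fintype.card F * #{v : Fin 3 → F | IsIsotropicNormal y v}
        + (Fintype.card F ^ 2 - Fintype.card F) *
            ((if (symMatrix y).det = 0 then 0 else 1)
              - (if y = 0 then (Fintype.card F : ℤ) ^ 2 else 0)) := by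
  by_cases hy : y = 0
  · subst hy
    have h0 : ∀ l m : Fin 3 → F, bil 0 l m = 0 := fun l m => by simp [bil]
    have hd : (symMatrix (0 : Fin 6 → F)).det = 0 := by
      rw [Matrix.det_fin_three]; simp [symMatrix]
    simp [h0, IsIsotropicNormal, hd]
    ring
  · by_cases hd : (symMatrix y).det = 0
    · rw [card_isotropic_of_det_eq_zero hy hd]
      simp [hy, hd]
    · rw [card_isotropic_of_det_ne_zero hd, card_isIsotropicNormal_of_det_ne_zero hd]
      simp [hy, hd]

/-! ### Duality between the forms singular at a point and the matrices isotropic on a line -/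

/-- The orthogonal complement with respect to the dot product; the forms in `dotOrth L` are those
whose hyperplanes contain `L`. -/
noncomputable def dotOrth {F : Type*} [Field F] (L : Submodule F (Fin 6 → F)) :
    Submodule F (Fin 6 → F) :=
  LinearMap.BilinForm.orthogonal (dotProductBilin F F) L

theorem mem_dotOrth {F : Type*} [Field F] {L : Submodule F (Fin 6 → F)} {a : Fin 6 → F} :
    a ∈ dotOrth L ↔ ∀ y ∈ L, y ⬝ᵥ a = 0 := Iff.rfl

theorem dotProductBilin_nondegenerate (F : Type*) [Field F] :
    (dotProductBilin F F : LinearMap.BilinForm F (Fin 6 → F)).Nondegenerate := by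
  refine ⟨fun x hx => ?_, fun x hx => ?_⟩
  · exact dotProduct_eq_zero_iff.mp hx
  · exact dotProduct_eq_zero_iff.mp fun z => by rw [dotProduct_comm]; exact hx z

theorem finrank_dotOrth {F : Type*} [Field F] (L : Submodule F (Fin 6 → F)) :
    Module.finrank F (dotOrth L) = 6 - Module.finrank F L := by
  rw [dotOrth, LinearMap.BilinForm.finrank_orthogonal (dotProductBilin_nondegenerate F)]
  simp

theorem dotOrth_dotOrth {F : Type*} [Field F] (L : Submodule F (Fin 6 → F)) :
    dotOrth (dotOrth L) = L :=
  LinearMap.BilinForm.orthogonal_orthogonal (dotProductBilin_nondegenerate F)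
    (fun x y h => by
      have h' : x ⬝ᵥ y = 0 := h
      show y ⬝ᵥ x = 0
      rw [dotProduct_comm, h']) L

/-- The quadratic forms that are singular at `v`. -/
def singularForms {F : Type*} [Field F] (v : Fin 3 → F) : Submodule F (Fin 6 → F) where
  carrier := {a | IsSingularAt a v}
  zero_mem' := by simp [IsSingularAt, evalForm, gradForm_eq_zero_iff]
  add_mem' := by
    rintro a b ⟨ha, ha'⟩ ⟨hb, hb'⟩
    rw [gradForm_eq_zero_iff] at ha' hb'
    obtain ⟨a1, a2, a3⟩ := ha'
    obtain ⟨b1, b2, b3⟩ := hb'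
    simp only [evalForm] at ha hb
    refine ⟨?_, gradForm_eq_zero_iff.mpr ⟨?_, ?_, ?_⟩⟩ <;>
      simp only [evalForm, Pi.add_apply]
    · linear_combination ha + hb
    · linear_combination a1 + b1
    · linear_combination a2 + b2
    · linear_combination a3 + b3
  smul_mem' := by
    rintro c a ⟨ha, ha'⟩
    rw [gradForm_eq_zero_iff] at ha'
    obtain ⟨a1, a2, a3⟩ := ha'
    simp only [evalForm] at ha
    refine ⟨?_, gradForm_eq_zero_iff.mpr ⟨?_, ?_, ?_⟩⟩ <;>
      simp only [evalForm, Pi.smul_apply, smul_eq_mul]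
    · linear_combination c * ha
    · linear_combination c * a1
    · linear_combination c * a2
    · linear_combination c * a3

/-- The points of `F⁶` whose symmetric matrix is isotropic on the orthogonal complement of `v`. -/
def isotropicMatrices {F : Type*} [Field F] (v : Fin 3 → F) : Submodule F (Fin 6 → F) where
  carrier := {y | IsIsotropicNormal y v}
  zero_mem' := fun a b => by simp [bil]
  add_mem' := fun {x y} hx hy a b => by
    have h1 := hx a b
    have h2 := hy a b
    simp only [bil] at h1 h2 ⊢
    rw [add_dotProduct, h1, h2, add_zero]
  smul_mem' := fun c y hy a b => by
    have h1 := hy a b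
    simp only [bil] at h1 ⊢
    rw [smul_dotProduct, h1, smul_zero]

theorem mem_singularForms {F : Type*} [Field F] {v : Fin 3 → F} {a : Fin 6 → F} :
    a ∈ singularForms v ↔ IsSingularAt a v := Iff.rfl

theorem mem_isotropicMatrices {F : Type*} [Field F] {v : Fin 3 → F} {y : Fin 6 → F} :
    y ∈ isotropicMatrices v ↔ IsIsotropicNormal y v := Iff.rfl

/-- A subspace has dimension three if three of the six coordinates parametrize it. -/
theorem finrank_eq_three {F : Type*} [Field F] {S : Submodule F (Fin 6 → F)} (i j k : Fin 6)
    (hinj : ∀ a ∈ S, a i = 0 → a j = 0 → a k = 0 → a = 0)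
    (hsurj : ∀ p q r : F, ∃ a ∈ S, a i = p ∧ a j = q ∧ a k = r) : Module.finrank F S = 3 := by
  let φ : S →ₗ[F] (Fin 3 → F) :=
    (LinearMap.pi ![LinearMap.proj i, LinearMap.proj j, LinearMap.proj k]) ∘ₗ S.subtype
  have hφ : Function.Bijective φ := by
    constructor
    · rw [injective_iff_map_eq_zero]
      rintro ⟨a, ha⟩ h
      have h0 := congrFun h 0
      have h1 := congrFun h 1
      have h2 := congrFun h 2
      simp [φ] at h0 h1 h2
      exact Subtype.ext (hinj a ha h0 h1 h2)
    · intro c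
      obtain ⟨a, ha, h0, h1, h2⟩ := hsurj (c 0) (c 1) (c 2)
      refine ⟨⟨a, ha⟩, ?_⟩
      ext n
      fin_cases n <;> simp [φ, *]
  rw [(LinearEquiv.ofBijective φ hφ).finrank_eq]
  simp

theorem finrank_singularForms {F : Type*} [Field F] {v : Fin 3 → F} (hv : v ≠ 0) :
    Module.finrank F (singularForms v) = 3 := by
  obtain ⟨i, hi⟩ := Function.ne_iff.mp hv
  fin_cases i <;> simp at hi
  · refine finrank_eq_three 3 4 5 ?_ fun p q r => ?_
    · rintro a ⟨h0, h⟩ e0 e1 e2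
      rw [gradForm_eq_zero_iff] at h
      obtain ⟨-, h2, h3⟩ := h
      simp [evalForm, e0, e1, e2, hi] at h0 h2 h3
      simp [h2, h3, hi] at h0
      ext n; fin_cases n <;> simp [*]
    · refine ⟨![(p * v 1 ^ 2 + q * v 1 * v 2 + r * v 2 ^ 2) / v 0 ^ 2,
        -(2 * p * v 1 + q * v 2) / v 0, -(q * v 1 + 2 * r * v 2) / v 0, p, q, r],
        ⟨?_, gradForm_eq_zero_iff.mpr ⟨?_, ?_, ?_⟩⟩, rfl, rfl, rfl⟩ <;>
      simp [evalForm] <;> field_simp <;> ring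
  · refine finrank_eq_three 0 2 5 ?_ fun p q r => ?_
    · rintro a ⟨h0, h⟩ e0 e1 e2
      rw [gradForm_eq_zero_iff] at h
      obtain ⟨h2, -, h3⟩ := h
      simp [evalForm, e0, e1, e2, hi] at h0 h2 h3
      simp [h2, h3, hi] at h0
      ext n; fin_cases n <;> simp [*]
    · refine ⟨![p, -(2 * p * v 0 + q * v 2) / v 1, q,
        (p * v 0 ^ 2 + q * v 0 * v 2 + r * v 2 ^ 2) / v 1 ^ 2,
        -(q * v 0 + 2 * r * v 2) / v 1, r],
        ⟨?_, gradForm_eq_zero_iff.mpr ⟨?_, ?_, ?_⟩⟩, rfl, rfl, rfl⟩ <;>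
      simp [evalForm] <;> field_simp <;> ring
  · refine finrank_eq_three 0 1 3 ?_ fun p q r => ?_
    · rintro a ⟨h0, h⟩ e0 e1 e2
      rw [gradForm_eq_zero_iff] at h
      obtain ⟨h2, h3, -⟩ := h
      simp [evalForm, e0, e1, e2, hi] at h0 h2 h3
      simp [h2, h3, hi] at h0
      ext n; fin_cases n <;> simp [*]
    · refine ⟨![p, q, -(2 * p * v 0 + q * v 1) / v 2, r,
        -(q * v 0 + 2 * r * v 1) / v 2,
        (p * v 0 ^ 2 + q * v 0 * v 1 + r * v 1 ^ 2) / v 2 ^ 2],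
        ⟨?_, gradForm_eq_zero_iff.mpr ⟨?_, ?_, ?_⟩⟩, rfl, rfl, rfl⟩ <;>
      simp [evalForm] <;> field_simp <;> ring

/-- The reason is that a form is singular at `v` if and only if it is a combination of products of
two linear forms that vanish at `v`, that is, of two forms `v × a` and `v × b`. -/
theorem dotOrth_singularForms {F : Type*} [Field F] {v : Fin 3 → F} (hv : v ≠ 0) :
    dotOrth (singularForms v) = isotropicMatrices v := by
  ext y
  rw [mem_dotOrth, mem_isotropicMatrices]
  constructor
  · intro h a b
    rw [bil, dotProduct_comm]
    apply h
    refine ⟨?_, gradForm_eq_zero_iff.mpr ⟨?_, ?_, ?_⟩⟩ <;>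
      simp [evalForm, prodForm, cross_apply] <;> ring
  · rintro h a ⟨h0, h'⟩
    obtain ⟨u, hu⟩ := exists_dotProduct_eq_one hv
    rw [gradForm_eq_zero_iff] at h'
    obtain ⟨h1, h2, h3⟩ := h'
    simp only [evalForm] at h0
    -- The linear form `x ↦ x i - v i * (u ⬝ᵥ x)` vanishes at `v`, and `a` is unchanged if each
    -- coordinate is replaced by the corresponding one of these forms.
    let p : Fin 3 → Fin 3 → F := fun i => Pi.single i 1 - v i • u
    have hp : ∀ i, p i = crossProduct v (crossProduct (Pi.single i 1) u) := by
      intro i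
      simp [dotProduct, Fin.sum_univ_three] at hu
      ext j
      fin_cases i <;> fin_cases j <;> simp [p, cross_apply] <;> linear_combination -hu
    have hpp : ∀ i j, bil y (p i) (p j) = 0 := fun i j => by rw [hp, hp]; exact h _ _
    have e : a = a 0 • prodForm (p 0) (p 0) + a 1 • prodForm (p 0) (p 1)
        + a 2 • prodForm (p 0) (p 2) + a 3 • prodForm (p 1) (p 1)
        + a 4 • prodForm (p 1) (p 2) + a 5 • prodForm (p 2) (p 2) := by
      ext n
      fin_cases n <;> simp [p, prodForm]
      · linear_combination u 0 * h1 - u 0 * u 0 * h0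
      · linear_combination u 0 * h2 + u 1 * h1 - 2 * u 0 * u 1 * h0
      · linear_combination u 0 * h3 + u 2 * h1 - 2 * u 0 * u 2 * h0
      · linear_combination u 1 * h2 - u 1 * u 1 * h0
      · linear_combination u 1 * h3 + u 2 * h2 - 2 * u 1 * u 2 * h0
      · linear_combination u 2 * h3 - u 2 * u 2 * h0
    simp only [bil] at hpp
    rw [dotProduct_comm, e]
    simp only [dotProduct_add, dotProduct_smul, hpp, smul_zero, add_zero]

/-- The codimension of the sum of `L` and `isotropicMatrices v`, of dimensions `2` and `3`, is one
more than the dimension of their intersection. -/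
theorem finrank_dotOrth_inf_singularForms {F : Type*} [Field F] {L : Submodule F (Fin 6 → F)}
    (hL : Module.finrank F L = 2) {v : Fin 3 → F} (hv : v ≠ 0) :
    Module.finrank F (dotOrth L ⊓ singularForms v : Submodule F (Fin 6 → F)) =
      1 + Module.finrank F (L ⊓ isotropicMatrices v : Submodule F (Fin 6 → F)) := by
  have h1 : dotOrth L ⊓ singularForms v = dotOrth (L ⊔ isotropicMatrices v) := by
    rw [← dotOrth_dotOrth (singularForms v), dotOrth_singularForms hv]
    ext a
    simp only [Submodule.mem_inf, mem_dotOrth]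
    constructor
    · rintro ⟨h, h'⟩ y hy
      obtain ⟨l, hl, n, hn, rfl⟩ := Submodule.mem_sup.mp hy
      rw [add_dotProduct, h l hl, h' n hn, add_zero]
    · exact fun h => ⟨fun y hy => h y (Submodule.mem_sup_left hy),
        fun y hy => h y (Submodule.mem_sup_right hy)⟩
  have h2 := Submodule.finrank_sup_add_finrank_inf_eq L (isotropicMatrices v)
  have h3 : Module.finrank F (isotropicMatrices v) = 3 := by
    rw [← dotOrth_singularForms hv, finrank_dotOrth, finrank_singularForms hv]
  rw [h1, finrank_dotOrth]
  omega

theorem card_mem_submodule {F V : Type*} [Field F] [Fintype F] [AddCommGroup V] [Module F V]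
    [Fintype V] (S : Submodule F V) [DecidablePred (· ∈ S)] :
    #{x : V | x ∈ S} = Fintype.card F ^ Module.finrank F S := by
  rw [← Module.card_eq_pow_finrank (K := F) (V := S), Fintype.card_subtype]

/-! ### The numbers of singular conics and of points of rank at most two -/

/-- The number of vectors of the web with vanishing discriminant, in terms of the number of
vectors of the line with singular matrix. Both numbers are compared with `T`, the number of pairs
of a vector `y` of the line and a normal of an isotropic plane of `y`, and with `d`, the number of
linear forms whose square lies in the web; `T` and `d` then cancel. -/
theorem card_coeffDiscr_eq_zero {F : Type*} [Field F] [Fintype F] {L : Submodule F (Fin 6 → F)}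
    (hL : Module.finrank F L = 2) :
    (#{a : Fin 6 → F | a ∈ dotOrth L ∧ coeffDiscr a = 0} : ℤ) =
      Fintype.card F ^ 3 - Fintype.card F ^ 2
        + Fintype.card F * #{y : Fin 6 → F | y ∈ L ∧ (symMatrix y).det = 0} := by
  set q : ℤ := ((Fintype.card F : ℕ) : ℤ) with hq
  have hq1 : 1 < q := by rw [hq]; exact_mod_cast Fintype.one_lt_card
  let W : Finset (Fin 6 → F) := {a | a ∈ dotOrth L}
  let P : Finset (Fin 6 → F) := {y | y ∈ L}
  have hW : (#W : ℤ) = q ^ 4 := by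
    simp only [W, card_mem_submodule, finrank_dotOrth, hL]; push_cast; rfl
  have hP : (#P : ℤ) = q ^ 2 := by
    simp only [P, card_mem_submodule, hL]; push_cast; rfl
  have h0W : (0 : Fin 6 → F) ∈ W := by simp [W]
  have h0P : (0 : Fin 6 → F) ∈ P := by simp [P]
  have hV : (Fintype.card (Fin 3 → F) : ℤ) = q ^ 3 := by simp [hq]
  let Z : ℤ := #{a ∈ W | coeffDiscr a = 0}
  let I : ℤ := #{y ∈ P | (symMatrix y).det = 0}
  let T : ℤ := ∑ y ∈ P, (#{v : Fin 3 → F | IsIsotropicNormal y v} : ℤ)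
  -- The number of linear forms whose square lies in the web.
  let d : ℤ := #{l : Fin 3 → F | prodForm l l ∈ dotOrth L}
  -- Pairs of a form of the web and one of its singular vectors.
  have hA : ∑ a ∈ W, (#{x : Fin 3 → F | IsSingularAt a x} : ℤ) = q ^ 4 - q ^ 3 + q * T := by
    have hswap : ∑ a ∈ W, (#{x : Fin 3 → F | IsSingularAt a x} : ℤ) =
        ∑ x : Fin 3 → F, (#{a ∈ W | IsSingularAt a x} : ℤ) := by
      exact_mod_cast Finset.sum_card_bipartiteAbove_eq_sum_card_bipartiteBelow
        (s := W) (t := Finset.univ) (fun a x => IsSingularAt a x)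
    have hT : T = ∑ x : Fin 3 → F, (#{y ∈ P | IsIsotropicNormal y x} : ℤ) := by
      simp only [T]
      exact_mod_cast Finset.sum_card_bipartiteAbove_eq_sum_card_bipartiteBelow
        (s := P) (t := Finset.univ) (fun y x => IsIsotropicNormal y x)
    have hterm : ∀ x ∈ (Finset.univ : Finset (Fin 3 → F)).erase 0,
        (#{a ∈ W | IsSingularAt a x} : ℤ) = q * #{y ∈ P | IsIsotropicNormal y x} := by
      intro x hx
      have hx := Finset.ne_of_mem_erase hx
      have e1 : #{a ∈ W | IsSingularAt a x} =
          #{a : Fin 6 → F | a ∈ dotOrth L ⊓ singularForms x} := by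
        congr 1; ext a; simp [W, mem_singularForms]
      have e2 : #{y ∈ P | IsIsotropicNormal y x} =
          #{y : Fin 6 → F | y ∈ L ⊓ isotropicMatrices x} := by
        congr 1; ext a; simp [P, mem_isotropicMatrices]
      rw [e1, e2, card_mem_submodule, card_mem_submodule,
        finrank_dotOrth_inf_singularForms hL hx]
      push_cast; rw [pow_add, pow_one]
    have hW0 : (#{a ∈ W | IsSingularAt a 0} : ℤ) = q ^ 4 := by
      simp [isSingularAt_zero, hW]
    have hP0 : (#{y ∈ P | IsIsotropicNormal y 0} : ℤ) = q ^ 2 := by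
      simp [isIsotropicNormal_zero, hP]
    rw [hswap, hT, ← Finset.add_sum_erase _ _ (Finset.mem_univ (0 : Fin 3 → F)),
      ← Finset.add_sum_erase _ _ (Finset.mem_univ (0 : Fin 3 → F)),
      Finset.sum_congr rfl hterm, ← Finset.mul_sum, hW0, hP0]
    ring
  -- Pairs of a nonzero form of the web and a linear form whose square is proportional to it.
  have hE : ∑ a ∈ W.erase 0, (#{l : Fin 3 → F | ∃ c : F, a = c • prodForm l l} : ℤ) =
      (d - 1) * (q - 1) := by
    have hswap : ∑ a ∈ W.erase 0, (#{l : Fin 3 → F | ∃ c : F, a = c • prodForm l l} : ℤ) =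
        ∑ l : Fin 3 → F, (#{a ∈ W.erase 0 | ∃ c : F, a = c • prodForm l l} : ℤ) := by
      exact_mod_cast Finset.sum_card_bipartiteAbove_eq_sum_card_bipartiteBelow
        (s := W.erase 0) (t := Finset.univ) (fun a l => ∃ c : F, a = c • prodForm l l)
    have hterm : ∀ l : Fin 3 → F, (#{a ∈ W.erase 0 | ∃ c : F, a = c • prodForm l l} : ℤ) =
        if l ≠ 0 ∧ prodForm l l ∈ dotOrth L then q - 1 else 0 := by
      intro l
      split_ifs with h
      · obtain ⟨hl, hlW⟩ := h
        have hne : prodForm l l ≠ 0 := by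
          intro h
          obtain ⟨u, hu⟩ := exists_dotProduct_eq_one hl
          have := evalForm_prodForm 1 l u
          rw [h, hu] at this
          simp [evalForm] at this
        have : ({a ∈ W.erase 0 | ∃ c : F, a = c • prodForm l l} : Finset (Fin 6 → F)) =
            ({c : F | c ≠ 0} : Finset F).image (fun c => c • prodForm l l) := by
          ext a
          simp only [Finset.mem_filter, Finset.mem_erase, Finset.mem_image, Finset.mem_univ,
            true_and, W]
          constructor
          · rintro ⟨⟨ha, -⟩, c, rfl⟩
            exact ⟨c, by rintro rfl; simp at ha, rfl⟩
          · rintro ⟨c, hc, rfl⟩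
            exact ⟨⟨smul_ne_zero hc hne, (dotOrth L).smul_mem c hlW⟩, c, rfl⟩
        rw [this, Finset.card_image_of_injective _ (smul_left_injective F hne),
          Finset.filter_ne', Finset.card_erase_of_mem (Finset.mem_univ _), Finset.card_univ,
          Nat.cast_sub Fintype.card_pos]
        simp [hq]
      · rw [Nat.cast_eq_zero, Finset.card_eq_zero, Finset.filter_eq_empty_iff]
        rintro a ha ⟨c, rfl⟩
        simp only [Finset.mem_erase, W, Finset.mem_filter, Finset.mem_univ, true_and] at ha
        obtain ⟨hne, hW⟩ := ha
        have hc : c ≠ 0 := by rintro rfl; simp at hne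
        refine h ⟨?_, ?_⟩
        · rintro rfl
          apply hne; ext i; fin_cases i <;> simp [prodForm]
        · have := (dotOrth L).smul_mem c⁻¹ hW
          rwa [smul_smul, inv_mul_cancel₀ hc, one_smul] at this
    have hd : (#{l : Fin 3 → F | l ≠ 0 ∧ prodForm l l ∈ dotOrth L} : ℤ) = d - 1 := by
      have : ({l : Fin 3 → F | l ≠ 0 ∧ prodForm l l ∈ dotOrth L} : Finset (Fin 3 → F)) =
          ({l : Fin 3 → F | prodForm l l ∈ dotOrth L} : Finset (Fin 3 → F)).erase 0 := by
        ext l; simp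
      have h0 : (0 : Fin 3 → F) ∈
          ({l : Fin 3 → F | prodForm l l ∈ dotOrth L} : Finset (Fin 3 → F)) := by
        have : prodForm (0 : Fin 3 → F) 0 = 0 := by
          ext i; fin_cases i <;> simp [prodForm]
        simp [this]
      rw [this, Finset.card_erase_of_mem h0, Nat.cast_sub (Finset.card_pos.mpr ⟨0, h0⟩)]
      simp [d]
    rw [hswap, Finset.sum_congr rfl fun l _ => hterm l, ← Finset.sum_filter, Finset.sum_const,
      nsmul_eq_mul, hd]
  have hZ : (∑ a ∈ W, if coeffDiscr a = 0 then (1 : ℤ) else 0) = Z := by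
    simp [Z]
  have hI : (∑ y ∈ P, if (symMatrix y).det = 0 then (0 : ℤ) else 1) = q ^ 2 - I := by
    have : ∀ y : Fin 6 → F, (if (symMatrix y).det = 0 then (0 : ℤ) else 1) =
        1 - if (symMatrix y).det = 0 then (1 : ℤ) else 0 := fun y => by split_ifs <;> simp
    simp only [this, Finset.sum_sub_distrib]
    simp [I, hP]
  -- The sum of `card_isSingularAt` over the nonzero forms of the web.
  have hA' : ∑ a ∈ W, (#{x : Fin 3 → F | IsSingularAt a x} : ℤ) =
      q ^ 3 + (q ^ 4 - 1) + (q - 1) * (Z - 1) + q * ((d - 1) * (q - 1)) := by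
    have h0 : coeffDiscr (0 : Fin 6 → F) = 0 := by simp [coeffDiscr]
    rw [← Finset.add_sum_erase _ _ h0W] at hZ ⊢
    rw [if_pos h0] at hZ
    rw [Finset.sum_congr rfl fun a ha => card_isSingularAt (Finset.ne_of_mem_erase ha),
      Finset.sum_add_distrib, Finset.sum_add_distrib, ← Finset.mul_sum, ← Finset.mul_sum, hE,
      eq_sub_of_add_eq' hZ, Finset.sum_const, Finset.card_erase_of_mem h0W, nsmul_eq_mul,
      Nat.cast_sub (Finset.card_pos.mpr ⟨0, h0W⟩), hW]
    have : (#{x : Fin 3 → F | IsSingularAt 0 x} : ℤ) = q ^ 3 := by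
      rw [← hV, ← Finset.card_univ]
      congr 2
      rw [Finset.filter_eq_self]
      intro x _
      simp [IsSingularAt, evalForm, gradForm_eq_zero_iff]
    rw [this]
    push_cast
    ring
  -- The sum of `card_isotropic` over the line.
  have hB : ∑ y ∈ P, (#{l : Fin 3 → F | bil y l l = 0} : ℤ) = q * T - (q ^ 2 - q) * I := by
    rw [Finset.sum_congr rfl fun y _ => card_isotropic y, Finset.sum_add_distrib,
      ← Finset.mul_sum, ← Finset.mul_sum, Finset.sum_sub_distrib, hI, Finset.sum_ite_eq' P,
      if_pos h0P]
    ring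
  -- Pairs of a vector of the line and an isotropic vector of its matrix.
  have hC : ∑ y ∈ P, (#{l : Fin 3 → F | bil y l l = 0} : ℤ) = q ^ 4 + d * (q ^ 2 - q) := by
    have hswap : ∑ y ∈ P, (#{l : Fin 3 → F | bil y l l = 0} : ℤ) =
        ∑ l : Fin 3 → F, (#{y ∈ P | bil y l l = 0} : ℤ) := by
      exact_mod_cast Finset.sum_card_bipartiteAbove_eq_sum_card_bipartiteBelow
        (s := P) (t := Finset.univ) (fun y l => bil y l l = 0)
    have hterm : ∀ l : Fin 3 → F, (#{y ∈ P | bil y l l = 0} : ℤ) =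
        q + if prodForm l l ∈ dotOrth L then q ^ 2 - q else 0 := by
      intro l
      split_ifs with h
      · have : ({y ∈ P | bil y l l = 0} : Finset (Fin 6 → F)) = P := by
          rw [Finset.filter_eq_self]
          intro y hy
          simp only [P, Finset.mem_filter, Finset.mem_univ, true_and] at hy
          exact mem_dotOrth.mp h y hy
        rw [this, hP]; ring
      · rw [mem_dotOrth] at h
        push Not at h
        obtain ⟨z, hz, hne⟩ := h
        have h := card_mul_card_ker (A := L) (B := F)
          { toFun := fun y => bil (y : Fin 6 → F) l l
            map_zero' := by simp [bil]
            map_add' := fun x y => by simp [bil, add_dotProduct] }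
          (fun t => ⟨(t / bil z l l) • ⟨z, hz⟩, by
            have hne' : bil z l l ≠ 0 := hne
            have : bil ((t / bil z l l) • z) l l = t / bil z l l * bil z l l := by
              simp only [bil, smul_dotProduct, smul_eq_mul]
            exact this.trans (div_mul_cancel₀ _ hne')⟩)
        have e : #{y ∈ P | bil y l l = 0} = #{y : L | bil (y : Fin 6 → F) l l = 0} := by
          refine (Finset.card_bij (fun (y : L) _ => (y : Fin 6 → F)) ?_ ?_ ?_).symm
          · intro y hy
            simpa [P] using hy
          · intro x _ y _ hxy
            exact Subtype.ext hxy
          · intro y hy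
            simp only [P, Finset.mem_filter, Finset.mem_univ, true_and] at hy
            exact ⟨⟨y, hy.1⟩, by simpa using hy.2, rfl⟩
        change #{y : L | bil (y : Fin 6 → F) l l = 0} * Fintype.card F = Fintype.card L at h
        rw [Module.card_eq_pow_finrank (K := F) (V := L), hL] at h
        rw [e, add_zero, Nat.eq_of_mul_eq_mul_right Fintype.card_pos (h.trans (sq _))]
    rw [hswap, Finset.sum_congr rfl fun l _ => hterm l, Finset.sum_add_distrib,
      ← Finset.sum_filter, Finset.sum_const, Finset.sum_const, Finset.card_univ, nsmul_eq_mul,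
      nsmul_eq_mul, hV]
    simp only [d]
    ring
  have key : (q - 1) * Z = (q - 1) * (q ^ 3 - q ^ 2 + q * I) := by
    linear_combination hA - hA' - hB + hC
  have hfin := mul_left_cancel₀ (by linarith : q - 1 ≠ 0 ) key
  simpa [Z, I, W, P, Finset.filter_filter] using hfin

/-! ### Counting projective points by vectors -/

/-- Each projective point accounts for `q - 1` nonzero vectors. -/
theorem card_eq_one_add_mul_ncard {F V : Type*} [Field F] [Fintype F] [AddCommGroup V]
    [Module F V] [Fintype V] {p : V → Prop} [DecidablePred p] {A : Set (ℙ F V)} (h0 : p 0)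
    (hA : ∀ v hv, p v ↔ Projectivization.mk F v hv ∈ A) :
    #{v : V | p v} = 1 + A.ncard * (Fintype.card F - 1) := by
  have hfin : Finite (ℙ F V) := Projectivization.finite_of_finite F V
  have hA' : A.Finite := A.toFinite
  have hsmul : ∀ (P : ℙ F V) (c : Fˣ), Projectivization.mk F (c • P.rep)
      ((smul_ne_zero_iff_ne c).mpr P.rep_nonzero) = P := by
    intro P c
    conv_rhs => rw [← P.mk_rep]
    rw [Projectivization.mk_eq_mk_iff]
    exact ⟨c, rfl⟩
  have h1 : #(({v : V | p v} : Finset V).erase 0) =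
      #(hA'.toFinset ×ˢ (Finset.univ : Finset Fˣ)) := by
    symm
    refine Finset.card_bij (fun x _ => x.2 • x.1.rep) ?_ ?_ ?_
    · rintro ⟨P, c⟩ h
      simp only [Finset.mem_product, Set.Finite.mem_toFinset, Finset.mem_univ, and_true] at h
      simp only [Finset.mem_erase, Finset.mem_filter, Finset.mem_univ, true_and]
      refine ⟨(smul_ne_zero_iff_ne c).mpr P.rep_nonzero, ?_⟩
      rw [hA _ ((smul_ne_zero_iff_ne c).mpr P.rep_nonzero), hsmul]
      exact h
    · rintro ⟨P, c⟩ _ ⟨P', c'⟩ _ h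
      simp only at h
      have hP : P = P' := by
        rw [← hsmul P c, ← hsmul P' c']
        congr 1
      subst hP
      have hc : (c : F) = c' := smul_left_injective F P.rep_nonzero h
      rw [Units.ext hc]
    · intro v hv
      simp only [Finset.mem_erase, Finset.mem_filter, Finset.mem_univ, true_and] at hv
      obtain ⟨hv0, hv⟩ := hv
      obtain ⟨a, ha⟩ := Projectivization.exists_smul_eq_mk_rep F v hv0
      refine ⟨(Projectivization.mk F v hv0, a⁻¹), ?_, ?_⟩
      · simpa using (hA v hv0).mp hv
      · simp only [← ha, inv_smul_smul]
  have h0' : (0 : V) ∈ ({v : V | p v} : Finset V) := by simpa using h0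
  rw [← Finset.card_erase_add_one h0', h1, Finset.card_product, Finset.card_univ,
    Fintype.card_units, Set.ncard_eq_toFinset_card A hA', add_comm]

theorem mk_mem_points {F V : Type*} [Field F] [AddCommGroup V] [Module F V] (W : Submodule F V)
    (v : V) (hv : v ≠ 0) : Projectivization.mk F v hv ∈ points W ↔ v ∈ W := by
  simp [points, Projectivization.submodule_mk]

theorem rank_le_two_iff {F : Type*} [Field F] (M : Matrix (Fin 3) (Fin 3) F) :
    M.rank ≤ 2 ↔ M.det = 0 := by
  constructor
  · intro h
    by_contra hd
    have := Matrix.rank_of_isUnit M ((Matrix.isUnit_iff_isUnit_det M).mpr (Ne.isUnit hd))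
    simp at this
    omega
  · intro h
    obtain ⟨v, hv, hv0⟩ := Matrix.exists_mulVec_eq_zero_iff.mpr h
    have h1 := LinearMap.finrank_range_add_finrank_ker M.mulVecLin
    have h2 : 0 < Module.finrank F (LinearMap.ker M.mulVecLin) := by
      rw [Module.finrank_pos_iff_exists_ne_zero]
      exact ⟨⟨v, by simpa using hv0⟩, fun h => hv (congrArg Subtype.val h)⟩
    simp at h1
    rw [Matrix.rank]
    omega

theorem card_det_eq_zero {F : Type*} [Field F] [Fintype F] (L : Submodule F (Fin 6 → F)) :
    #{y : Fin 6 → F | y ∈ L ∧ (symMatrix y).det = 0} =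
      1 + (points L ∩ secantVariety F).ncard * (Fintype.card F - 1) := by
  apply card_eq_one_add_mul_ncard
  · refine ⟨L.zero_mem, ?_⟩
    rw [Matrix.det_fin_three]
    simp [symMatrix]
  · intro v hv
    rw [Set.mem_inter_iff, mk_mem_points, mk_mem_secantVariety, rank_le_two_iff]

/-- The determinant restricts to a binary cubic form on a line, which vanishes identically or has
at most three zeros. -/
theorem ncard_points_inter_secantVariety {F : Type*} [Field F] [Fintype F]
    {L : Submodule F (Fin 6 → F)} (hL : Module.finrank F L = 2) :
    (points L ∩ secantVariety F).ncard ≤ 3 ∨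
      (points L ∩ secantVariety F).ncard = Fintype.card F + 1 := by
  have hq : 1 < Fintype.card F := Fintype.one_lt_card
  have hI := card_det_eq_zero L
  by_cases h : ∀ y ∈ L, (symMatrix y).det = 0
  · right
    have : #{y : Fin 6 → F | y ∈ L ∧ (symMatrix y).det = 0} = Fintype.card F ^ 2 := by
      rw [← hL, ← card_mem_submodule]
      congr 1
      ext y
      simpa using h y
    rw [this] at hI
    obtain ⟨n, hn⟩ : ∃ n, Fintype.card F = n + 1 := ⟨Fintype.card F - 1, by omega⟩
    rw [hn] at hI hq ⊢
    rw [Nat.add_sub_cancel] at hI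
    exact Nat.eq_of_mul_eq_mul_right (by omega : 0 < n) (by linarith)
  · left
    push Not at h
    obtain ⟨y, hy, hd⟩ := h
    have hy0 : y ≠ 0 := by
      rintro rfl
      apply hd
      rw [Matrix.det_fin_three]
      simp [symMatrix]
    -- A second vector `z` spanning the line together with `y`.
    obtain ⟨z, hz, hzy⟩ : ∃ z ∈ L, z ∉ Submodule.span F {y} := by
      by_contra! hle
      have h1 := Submodule.finrank_mono (show L ≤ Submodule.span F {y} from hle)
      rw [hL, finrank_span_singleton hy0] at h1
      omega
    have hspan : ∀ w ∈ L, ∃ s t : F, w = s • y + t • z := by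
      have hle : Submodule.span F {y, z} ≤ L := by
        rw [Submodule.span_le]
        rintro x (rfl | rfl) <;> assumption
      have hlin : LinearIndependent F ![y, z] := by
        rw [LinearIndependent.pair_iff' hy0]
        intro a ha
        exact hzy (Submodule.mem_span_singleton.mpr ⟨a, ha⟩)
      have h2 : Module.finrank F (Submodule.span F {y, z}) = 2 := by
        have := finrank_span_eq_card hlin
        rw [Matrix.range_cons_cons_empty] at this
        simpa using this
      have := Submodule.eq_of_le_of_finrank_eq hle (by rw [h2, hL])
      intro w hw
      rw [← this] at hw
      obtain ⟨s, t, h⟩ := Submodule.mem_span_pair.mp hw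
      exact ⟨s, t, h.symm⟩
    let g : Polynomial F := ((Polynomial.X : Polynomial F) • (symMatrix y).map Polynomial.C
      + (symMatrix z).map Polynomial.C).det
    have hg0 : g ≠ 0 := by
      intro hg
      have := Polynomial.coeff_det_X_add_C_card (symMatrix y) (symMatrix z)
      rw [show Matrix.det _ = g from rfl, hg] at this
      exact hd (by simpa using this.symm)
    have hdeg : g.natDegree ≤ 3 := by
      simpa using Polynomial.natDegree_det_X_add_C_le (symMatrix y) (symMatrix z)
    have hroot : ∀ t, g.eval t = (symMatrix (t • y + z)).det := by
      intro t
      rw [← Polynomial.coe_evalRingHom, RingHom.map_det]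
      congr 1
      ext i j
      fin_cases i <;> fin_cases j <;> simp [symMatrix] <;> ring
    have hsub : ({w : Fin 6 → F | w ∈ L ∧ (symMatrix w).det = 0} : Finset (Fin 6 → F)) ⊆
        insert 0 ((({c : F | c ≠ 0} : Finset F) ×ˢ g.roots.toFinset).image
          fun p => p.1 • (p.2 • y + z)) := by
      intro w hw
      simp only [Finset.mem_filter, Finset.mem_univ, true_and] at hw
      obtain ⟨hwL, hwd⟩ := hw
      obtain ⟨s, t, rfl⟩ := hspan w hwL
      simp only [Finset.mem_insert, Finset.mem_image, Finset.mem_product, Finset.mem_filter,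
        Finset.mem_univ, true_and, Multiset.mem_toFinset, Polynomial.mem_roots hg0,
        Polynomial.IsRoot.def, hroot]
      by_cases ht : t = 0
      · left
        rw [ht, zero_smul, add_zero, symMatrix_smul, Matrix.det_smul] at hwd
        have hs : s = 0 := by simpa [hd] using hwd
        simp [hs, ht]
      · right
        have e : s • y + t • z = t • ((t⁻¹ * s) • y + z) := by
          rw [smul_add, smul_smul, mul_inv_cancel_left₀ ht]
        refine ⟨(t, t⁻¹ * s), ⟨ht, ?_⟩, e.symm⟩
        rw [e, symMatrix_smul, Matrix.det_smul] at hwd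
        simpa [ht] using hwd
    have hcard := (Finset.card_le_card hsub).trans (Finset.card_insert_le _ _)
    have hcard2 := hcard.trans (Nat.add_le_add_right Finset.card_image_le 1)
    rw [Finset.card_product, Finset.filter_ne', Finset.card_erase_of_mem (Finset.mem_univ _),
      Finset.card_univ, hI] at hcard2
    have hroots : #g.roots.toFinset ≤ 3 :=
      (Multiset.toFinset_card_le _).trans (g.card_roots'.trans hdeg)
    refine Nat.le_of_mul_le_mul_right ?_ (by omega : 0 < Fintype.card F - 1)
    have := Nat.mul_le_mul_left (Fintype.card F - 1) hroots
    linarith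

/-! ### The cubic surface in terms of coefficient vectors -/

/-- The coefficient vector of a ternary quadratic form. -/
noncomputable def coeffVec (F : Type*) [Field F] : MvPolynomial (Fin 3) F →ₗ[F] (Fin 6 → F) where
  toFun f := ![quadCoeff f 0 0, quadCoeff f 0 1, quadCoeff f 0 2, quadCoeff f 1 1,
    quadCoeff f 1 2, quadCoeff f 2 2]
  map_add' f g := by ext i; fin_cases i <;> simp [quadCoeff]
  map_smul' c f := by ext i; fin_cases i <;> simp [quadCoeff]

theorem hyperplaneForm_eq {F : Type*} [Field F] (f : MvPolynomial (Fin 3) F) (y : Fin 6 → F) :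
    hyperplaneForm f y = y ⬝ᵥ coeffVec F f := by
  simp [hyperplaneForm, coeffVec, dotProduct, Fin.sum_univ_six]
  ring

theorem coeffDiscr_coeffVec {F : Type*} [Field F] (f : MvPolynomial (Fin 3) F) :
    coeffDiscr (coeffVec F f) = discr f := by
  simp [coeffDiscr, coeffVec, discr]

/-- The six coefficients in `coeffVec` are all those of a form of degree two. -/
theorem eq_zero_of_coeffVec_eq_zero {F : Type*} [Field F] {f : MvPolynomial (Fin 3) F}
    (hf : f.IsHomogeneous 2) (h : coeffVec F f = 0) : f = 0 := by
  have h0 := congrFun h 0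
  have h1 := congrFun h 1
  have h2 := congrFun h 2
  have h3 := congrFun h 3
  have h4 := congrFun h 4
  have h5 := congrFun h 5
  simp [coeffVec, quadCoeff] at h0 h1 h2 h3 h4 h5
  ext m
  rw [MvPolynomial.coeff_zero]
  by_cases hm : m.degree = 2
  · have hs : m 0 + m 1 + m 2 = 2 := by
      rwa [Finsupp.degree_eq_sum, Fin.sum_univ_three] at hm
    have key : ∀ i j : Fin 3, (∀ k, m k = (Finsupp.single i 1 + Finsupp.single j 1 : Fin 3 →₀ ℕ) k)
        → f.coeff (Finsupp.single i 1 + Finsupp.single j 1) = 0 → f.coeff m = 0 := by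
      intro i j hij hc
      rwa [Finsupp.ext hij]
    have hcases : (m 0 = 2 ∧ m 1 = 0 ∧ m 2 = 0) ∨ (m 0 = 1 ∧ m 1 = 1 ∧ m 2 = 0) ∨
        (m 0 = 1 ∧ m 1 = 0 ∧ m 2 = 1) ∨ (m 0 = 0 ∧ m 1 = 2 ∧ m 2 = 0) ∨
        (m 0 = 0 ∧ m 1 = 1 ∧ m 2 = 1) ∨ (m 0 = 0 ∧ m 1 = 0 ∧ m 2 = 2) := by omega
    rcases hcases with h | h | h | h | h | h <;> obtain ⟨e0, e1, e2⟩ := h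
    · exact key 0 0 (fun k => by fin_cases k <;> simp [*]) h0
    · exact key 0 1 (fun k => by fin_cases k <;> simp [*]) h1
    · exact key 0 2 (fun k => by fin_cases k <;> simp [*]) h2
    · exact key 1 1 (fun k => by fin_cases k <;> simp [*]) h3
    · exact key 1 2 (fun k => by fin_cases k <;> simp [*]) h4
    · exact key 2 2 (fun k => by fin_cases k <;> simp [*]) h5
  · exact hf.coeff_eq_zero hm

theorem eval_quadCoeff_genericMember {F : Type*} [Field F] (f : Fin 4 → MvPolynomial (Fin 3) F)
    (x : Fin 4 → F) (i j : Fin 3) :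
    MvPolynomial.eval x (quadCoeff (genericMember f) i j) =
      quadCoeff (∑ k, x k • f k) i j := by
  simp [quadCoeff, genericMember, MvPolynomial.coeff_sum, MvPolynomial.coeff_C_mul,
    MvPolynomial.coeff_map]

theorem eval_discr_genericMember {F : Type*} [Field F] (f : Fin 4 → MvPolynomial (Fin 3) F)
    (x : Fin 4 → F) :
    MvPolynomial.eval x (discr (genericMember f)) = coeffDiscr (coeffVec F (∑ k, x k • f k)) := by
  rw [coeffDiscr_coeffVec]
  simp only [discr, map_add, map_sub, map_mul, map_pow, eval_quadCoeff_genericMember]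
  simp

theorem coeffDiscr_smul {F : Type*} [Field F] (c : F) (a : Fin 6 → F) :
    coeffDiscr (c • a) = c ^ 3 * coeffDiscr a := by
  simp [coeffDiscr]
  ring

theorem card_cubicSurface {F : Type*} [Field F] [Fintype F]
    (f : Fin 4 → MvPolynomial (Fin 3) F) :
    #{x : Fin 4 → F | coeffDiscr (coeffVec F (∑ k, x k • f k)) = 0} =
      1 + (cubicSurface f).ncard * (Fintype.card F - 1) := by
  apply card_eq_one_add_mul_ncard
  · simp [coeffDiscr]
  · intro v hv
    obtain ⟨c, hc⟩ := Projectivization.exists_smul_eq_mk_rep F v hv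
    have e : ∑ k, (c • v) k • f k = (c : F) • ∑ k, v k • f k := by
      rw [Finset.smul_sum]
      exact Finset.sum_congr rfl fun k _ => by rw [smul_smul]; rfl
    simp only [cubicSurface, zeroLocus, Set.mem_ofPred_eq]
    rw [← hc, eval_discr_genericMember, e, map_smul, coeffDiscr_smul]
    simp

/-- The basis of the web identifies the coordinates of `PG(3,q)` with the coefficient vectors of the
forms of the web. -/
theorem card_discr_web {F : Type*} [Field F] [Fintype F] {L : Submodule F (Fin 6 → F)}
    (hL : Module.finrank F L = 2) {f : Fin 4 → MvPolynomial (Fin 3) F} (hf : DetermineWeb f L) :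
    #{x : Fin 4 → F | coeffDiscr (coeffVec F (∑ k, x k • f k)) = 0} =
      #{a : Fin 6 → F | a ∈ dotOrth L ∧ coeffDiscr a = 0} := by
  obtain ⟨hlin, hspan⟩ := hf
  let Φ : (Fin 4 → F) →ₗ[F] (Fin 6 → F) := coeffVec F ∘ₗ Fintype.linearCombination F f
  have hΦ : ∀ x, Φ x = coeffVec F (∑ k, x k • f k) := fun x => by
    simp [Φ, Fintype.linearCombination_apply]
  have hmem : ∀ x : Fin 4 → F, ∑ k, x k • f k ∈ associatedSystem L := fun x => by
    rw [← hspan]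
    exact Submodule.sum_mem _ fun k _ =>
      Submodule.smul_mem _ _ (Submodule.subset_span ⟨k, rfl⟩)
  have hinj : Function.Injective Φ := by
    rw [injective_iff_map_eq_zero]
    intro x hx
    rw [hΦ] at hx
    have := eq_zero_of_coeffVec_eq_zero (hmem x).1 hx
    exact funext (Fintype.linearIndependent_iff.mp hlin x this)
  have hle : LinearMap.range Φ ≤ dotOrth L := by
    rintro _ ⟨x, rfl⟩
    rw [hΦ, mem_dotOrth]
    intro y hy
    rw [← hyperplaneForm_eq]
    exact (hmem x).2 y hy
  have hrange : LinearMap.range Φ = dotOrth L := by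
    apply Submodule.eq_of_le_of_finrank_eq hle
    rw [LinearMap.finrank_range_of_inj hinj, finrank_dotOrth, hL]
    simp
  refine Finset.card_bij (fun x _ => Φ x) ?_ (fun x _ y _ h => hinj h) ?_
  · intro x hx
    simp only [Finset.mem_filter, Finset.mem_univ, true_and] at hx ⊢
    exact ⟨hle ⟨x, rfl⟩, by rwa [hΦ]⟩
  · intro a ha
    simp only [Finset.mem_filter, Finset.mem_univ, true_and] at ha
    obtain ⟨hW, hd⟩ := ha
    rw [← hrange] at hW
    obtain ⟨x, rfl⟩ := hW
    exact ⟨x, by simpa [← hΦ] using hd, rfl⟩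

/-- With `i` the number of points of the line in the secant variety, the cubic surface has
`q ^ 2 + i * q + 1` points. -/
theorem ncard_cubicSurface {F : Type*} [Field F] [Fintype F] {L : Submodule F (Fin 6 → F)}
    (hL : Module.finrank F L = 2) {f : Fin 4 → MvPolynomial (Fin 3) F} (hf : DetermineWeb f L) :
    (cubicSurface f).ncard = Fintype.card F ^ 2
      + (points L ∩ secantVariety F).ncard * Fintype.card F + 1 := by
  have h := card_coeffDiscr_eq_zero hL
  rw [← card_discr_web hL hf, card_cubicSurface, card_det_eq_zero] at h
  have hq : 1 < Fintype.card F := Fintype.one_lt_card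
  push_cast [hq.le] at h
  have hq' : (Fintype.card F : ℤ) - 1 ≠ 0 := by
    have : (1 : ℤ) < Fintype.card F := by exact_mod_cast hq
    linarith
  zify
  apply mul_right_cancel₀ hq'
  linear_combination h

end VeroneseWeb

theorem mainTheorem6 {F : Type*} [Field F] [Fintype F] (q : ℕ) (hq : Fintype.card F = q)
    (L : Submodule F (Fin 6 → F)) (hL : Module.finrank F L = 2)
    (f : Fin 4 → MvPolynomial (Fin 3) F) (hf : VeroneseWeb.DetermineWeb f L) :
    (VeroneseWeb.points L ∩ VeroneseWeb.secantVariety F).ncard ∈ ({0, 1, 2, 3, q + 1} : Set ℕ) ∧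
    ∀ i ∈ ({0, 1, 2, 3, q + 1} : Set ℕ),
      ((VeroneseWeb.points L ∩ VeroneseWeb.secantVariety F).ncard = i ↔
        (VeroneseWeb.cubicSurface f).ncard = q ^ 2 + i * q + 1) := by
  subst hq
  refine ⟨?_, fun i _ => ?_⟩
  · have := VeroneseWeb.ncard_points_inter_secantVariety hL
    simp only [Set.mem_insert_iff, Set.mem_singleton_iff]
    omega
  · rw [VeroneseWeb.ncard_cubicSurface hL hf]
    have hq : 0 < Fintype.card F := Fintype.card_pos
    simp [hq.ne']
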